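/- **Setting.** An injective (left-canonical) translation-invariant MPS tensor is a family $A=(A^s)_{s=1}^d$ of $\chi\times\chi$ complex matrices with $\sum_s (A^s)^\dagger A^s=\mathbb 1$, with a positive definite $\rho$ such that $\sum_s A^s\rho (A^s)^\dagger=\rho$, and such that the eigenvalue $1$ of the transfer matrix $\sum_s A^s\otimes (A^s)^*$ has a one-dimensional eigenspace while all its other eigenvalues have modulus $<1$. Its periodic state on $n$ sites is $|\psi_n\rangle=\sum \mathrm{Tr}(A^{s_1}\cdots A^{s_n})|s_1\ldots s_n\rangle$. Let $G_a,G_b$ be (discrete) abelian groups, $a,b\in\mathbb Z$, and $L\ge1$ with $g^{a^L}=g$ for all $g\in G_a$ and $g^{b^L}=g$ for all $g\in G_b$ (periodic boundary conditions). Let $U$ be a unitary linear representation of $G_a\times G_b$ on the on-site space $\mathbb C^d$, and consider the two exponential symmetries $\mathcal U_{g_a}=\bigotimes_{j=1}^L U_{g_a}^{a^{j-1}}$, $\mathcal U_{g_b}=\bigotimes_{j=1}^L U_{g_b}^{b^{j-1}}$. The MPS is called symmetric if for every $k\ge1$ the state $|\psi_{kL}\rangle$ is an eigenstate, with eigenvalue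 a phase, of the $k$-fold periodic extension of $\mathcal U_{g_a}\mathcal U_{g_b}$, for all $g_a,g_b$. Bond unitaries are unitary $\chi\times\chi$ matrices $v_j(g)$, $g=(g_a,g_b)$, $j\in\mathbb Z/L$, with $(U_{g_a}^{a^{j-1}}U_{g_b}^{b^{j-1}})\cdot A = (\text{phase})\; v_{j-1}(g)^\dagger A\, v_j(g)$ for $1\le j\le L$. **(1) Cocycle constraints.** For every symmetric injective MPS, bond unitaries exist. There is one class $c\in H^2(G_a\times G_b,U(1))$ such that for every choice of bond unitaries and every bond $j$, $v_j(g)v_j(h)=\omega_j(g,h)\,v_j(gh)$ with a $2$-cocycle $\omega_j$ of class $c$. Let $\omega_a$, $\omega_b$ be the restrictions of $\omega_j$ to $G_a$, $G_b$, and let $\phi=\omega_j/(\mathrm{pr}_a^*\omega_a\cdot \mathrm{pr}_b^*\omega_b)$ be its mixed part. Then, up to coboundaries, $$\omega_a^{a^2-1}=1,\qquad \phi^{ab-1}=1,\qquad \omega_b^{b^2-1}=1,$$ and in particular the coboundary-invariant phase $\omega_j(g_a,g_b)\,\omega_j(g_b,g_a)^{-1}$ has $(ab-1)$-st power $1$ for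 all $g_a\in G_a$, $g_b\in G_b$. **(2) Charge plus exponential symmetry.** Let $G_a=G_b=\mathbb Z_N$ ($N\ge1$), $a=1$, and let $L\ge1$ satisfy $b^L\equiv 1 \pmod N$. Then every $U(1)$-valued $2$-cocycle on $\mathbb Z_N$ is a coboundary, and there is an isomorphism $H^2(\mathbb Z_N\times\mathbb Z_N,U(1))\cong\mathbb Z_N$, $[\omega]\mapsto k$, characterized by $\omega(g_a,g_b)\,\omega(g_b,g_a)^{-1}=\exp(2\pi i k g_ag_b/N)$ for $g_a,g_b\in\mathbb{Z}_N$. A class is carried by the bond unitaries of some symmetric injective MPS (for some $d$, $\chi$ and on-site linear representation $U$) if and only if $k$ is a multiple of $N/\gcd(b-1,N)$. The set of these classes, which are the (strong) SPT phases protected by the charge and exponential symmetries, is a subgroup isomorphic to $\mathbb Z_{\gcd(b-1,N)}$. -/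

import Mathlib

noncomputable section

namespace ModulatedMPS

open Matrix
open scoped Kronecker ComplexOrder

/-! ## Second group cohomology with coefficients in `U(1)` (trivial action) -/

/-- `U(1)`-valued 2-cocycles on `G`. -/
def Z2 (G : Type*) [Group G] : Subgroup (G → G → Circle) where
  carrier := {ω | ∀ g h k, ω g h * ω (g * h) k = ω h k * ω g (h * k)}
  one_mem' := by intro g h k; simp
  mul_mem' := by
    intro x y hx hy g h k
    simp only [Pi.mul_apply]
    rw [mul_mul_mul_comm, hx g h k, hy g h k, mul_mul_mul_comm]
  inv_mem' := by
    intro x hx g h k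
    simp only [Pi.inv_apply]
    rw [← mul_inv, hx g h k, mul_inv]

/-- `U(1)`-valued 2-coboundaries on `G`. -/
def B2 (G : Type*) [Group G] : Subgroup (G → G → Circle) where
  carrier := {ω | ∃ β : G → Circle, ∀ g h, ω g h = β g * β h / β (g * h)}
  one_mem' := ⟨fun _ => 1, by intro g h; simp⟩
  mul_mem' := by
    rintro x y ⟨β, hβ⟩ ⟨γ, hγ⟩
    refine ⟨fun g => β g * γ g, fun g h => ?_⟩
    simp only [Pi.mul_apply]
    rw [hβ, hγ, div_mul_div_comm, mul_mul_mul_comm]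
  inv_mem' := by
    rintro x ⟨β, hβ⟩
    refine ⟨fun g => (β g)⁻¹, fun g h => ?_⟩
    simp only [Pi.inv_apply]
    rw [hβ, inv_div, div_eq_mul_inv, div_eq_mul_inv, inv_inv, mul_inv, mul_comm]

/-- The group `H²(G, U(1))`: cocycles modulo coboundaries. -/
abbrev H2 (G : Type*) [Group G] : Type _ := Z2 G ⧸ (B2 G).subgroupOf (Z2 G)

/-- The cohomology class of a 2-cocycle. -/
def H2.mk {G : Type*} [Group G] (ω : Z2 G) : H2 G := QuotientGroup.mk ω

/-- `ω` is the factor system of the family `v`, i.e. `v g * v h = ω(g,h) v (g h)`. -/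
def IsFactorSystem {G : Type*} [Group G] {χ : ℕ}
    (v : G → unitaryGroup (Fin χ) ℂ) (ω : G → G → Circle) : Prop :=
  ∀ g h, (v g * v h : Matrix (Fin χ) (Fin χ) ℂ)
    = (ω g h : ℂ) • (v (g * h) : Matrix (Fin χ) (Fin χ) ℂ)

section Sectors

variable {Ga Gb : Type*} [Group Ga] [Group Gb]

/-- The `a-a` sector `ω_a(g_a, h_a)` of a function of two variables on `Ga × Gb`. -/
def sectorA (ω : Ga × Gb → Ga × Gb → Circle) : Ga → Ga → Circle :=
  fun g h => ω (g, 1) (h, 1)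

/-- The `b-b` sector `ω_b(g_b, h_b)`. -/
def sectorB (ω : Ga × Gb → Ga × Gb → Circle) : Gb → Gb → Circle :=
  fun g h => ω (1, g) (1, h)

/-- The mixed `a-b` sector, as a 2-cocycle on `Ga × Gb`: what is left of `ω` after the pull-backs
of its `a-a` and `b-b` sectors along the two projections have been divided out. -/
def sectorMixed (ω : Ga × Gb → Ga × Gb → Circle) : Ga × Gb → Ga × Gb → Circle :=
  fun g h => ω g h / (sectorA ω g.1 h.1 * sectorB ω g.2 h.2)

/-- The coboundary-invariant phase `φ(g_a, g_b) φ(g_b, g_a)⁻¹` of the mixed sector. -/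
def mixedPhase (ω : Ga × Gb → Ga × Gb → Circle) (ga : Ga) (gb : Gb) : Circle :=
  ω (ga, 1) (1, gb) / ω (1, gb) (ga, 1)

end Sectors

/-! ## Translation-invariant matrix product states -/

section MPS

variable {d χ : ℕ}

/-- The transfer matrix `∑ₛ Aˢ ⊗ (Aˢ)*`. -/
def transferMatrix (A : Fin d → Matrix (Fin χ) (Fin χ) ℂ) :
    Matrix (Fin χ × Fin χ) (Fin χ × Fin χ) ℂ :=
  ∑ s, A s ⊗ₖ (A s).map (starRingEnd ℂ)

/-- A left-canonical injective MPS tensor: the identity is a left fixed point of the transfer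
matrix, there is a positive definite right fixed point `ρ`, and the dominant eigenvalue `1` of the
transfer matrix has a unique eigenvector and is separated from all other eigenvalues by a gap. -/
structure IsInjectiveMPS (A : Fin d → Matrix (Fin χ) (Fin χ) ℂ) : Prop where
  left_canonical : ∑ s, (A s)ᴴ * A s = 1
  right_fixed : ∃ ρ : Matrix (Fin χ) (Fin χ) ℂ, ρ.PosDef ∧ ∑ s, A s * ρ * (A s)ᴴ = ρ
  unique_dominant :
    Module.finrank ℂ (Module.End.eigenspace (Matrix.toLin' (transferMatrix A)) 1) = 1
  gap : ∀ μ : ℂ, Module.End.HasEigenvalue (Matrix.toLin' (transferMatrix A)) μ → μ ≠ 1 → ‖μ‖ < 1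

/-- The periodic MPS on `n` sites: the amplitude of the configuration `s` is
`Tr (A^{s₁} ⋯ A^{sₙ})`. -/
def mpsState (A : Fin d → Matrix (Fin χ) (Fin χ) ℂ) (n : ℕ) (s : Fin n → Fin d) : ℂ :=
  (List.ofFn fun i => A (s i)).prod.trace

/-- The state `ψ` on `n` sites satisfies `(W₁ ⊗ ⋯ ⊗ Wₙ) ψ = e^{iθ} ψ` for some phase. -/
def IsTensorEigenstate {n : ℕ} (W : Fin n → unitaryGroup (Fin d) ℂ)
    (ψ : (Fin n → Fin d) → ℂ) : Prop :=
  ∃ θ : Circle, ∀ s : Fin n → Fin d,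
    ∑ s' : Fin n → Fin d, (∏ i, (W i : Matrix (Fin d) (Fin d) ℂ) (s i) (s' i)) * ψ s'
      = (θ : ℂ) * ψ s

/-- Bond unitaries on a ring of `L` sites, for a family `W` of on-site unitaries labelled by `G`:
`W_i(g) · A ≐ v_i(g)† A v_{i+1}(g)` at every site `i`, where `≐` is equality up to a phase.
Site `i` lies between bond `i` (on its left) and bond `i + 1` (on its right), and bond `L` is
bond `0`. -/
def IsBondUnitaries {G : Type*} {L : ℕ} [NeZero L] (A : Fin d → Matrix (Fin χ) (Fin χ) ℂ)
    (W : Fin L → G → unitaryGroup (Fin d) ℂ) (v : Fin L → G → unitaryGroup (Fin χ) ℂ) : Prop :=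
  ∀ (i : Fin L) (g : G), ∃ θ : Circle, ∀ s : Fin d,
    ∑ s' : Fin d, (W i g : Matrix (Fin d) (Fin d) ℂ) s s' • A s'
      = (θ : ℂ) • ((v i g : Matrix (Fin χ) (Fin χ) ℂ)ᴴ * A s
          * (v (i + 1) g : Matrix (Fin χ) (Fin χ) ℂ))

end MPS

/-! ## Two exponential symmetries -/

section Exponential

variable {Ga Gb : Type*} [Group Ga] [Group Gb] {d χ : ℕ}

/-- The on-site unitary `U_{g_a}^{a^j} U_{g_b}^{b^j}` of `𝒰_{g_a} 𝒰_{g_b}` at the site with index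
`j` (sites are counted from `0`). -/
def siteUnitary (U : Ga × Gb →* unitaryGroup (Fin d) ℂ) (a b : ℤ) (j : ℕ) (g : Ga × Gb) :
    unitaryGroup (Fin d) ℂ :=
  U (g.1, 1) ^ (a ^ j) * U (1, g.2) ^ (b ^ j)

/-- For every `k ≥ 1`, the MPS on `k L` sites is an eigenstate of the `k`-fold periodic extension
of each of the modulated symmetry operators on `L` sites. -/
def IsSymmetricMPS (A : Fin d → Matrix (Fin χ) (Fin χ) ℂ)
    (U : Ga × Gb →* unitaryGroup (Fin d) ℂ) (a b : ℤ) (L : ℕ) : Prop :=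
  ∀ (g : Ga × Gb) (k : ℕ), 0 < k →
    IsTensorEigenstate (fun i : Fin (k * L) => siteUnitary U a b (i.val % L) g)
      (mpsState A (k * L))

/-- The (strong) SPT classes of two exponential symmetries on chains with an `L`-site unit cell:
the classes in `H²(Ga × Gb, U(1))` carried by the bond unitaries of symmetric injective
translation-invariant MPS whose sites carry linear representations of `Ga × Gb`. -/
def sptClasses (Ga Gb : Type*) [Group Ga] [Group Gb] (a b : ℤ) (L : ℕ) [NeZero L] :
    Set (H2 (Ga × Gb)) :=
  {c | ∃ (d χ : ℕ) (A : Fin d → Matrix (Fin χ) (Fin χ) ℂ)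
      (U : Ga × Gb →* unitaryGroup (Fin d) ℂ),
      IsInjectiveMPS A ∧ IsSymmetricMPS A U a b L ∧
      ∃ v : Fin L → Ga × Gb → unitaryGroup (Fin χ) ℂ,
        IsBondUnitaries A (fun i g => siteUnitary U a b i.val g) v ∧
        ∀ i, ∃ ω : Z2 (Ga × Gb), IsFactorSystem (v i) ω.1 ∧ H2.mk ω = c}

end Exponential

end ModulatedMPS

end

/-! The proof has three ingredients. The first is the gauge theorem `exists_unitary_gauge`. The
overlap of the MPS on `k L` sites with its image under the symmetry is the trace of the `k`-th power
of a mixed transfer matrix. Symmetry makes its modulus equal to the squared norm of the state, which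
tends to `1`, so the mixed transfer matrix has an eigenvalue of modulus at least `1`. Transporting
an eigenvector around the ring cannot increase its norm weighted by `ρ`. Equality must therefore
hold at every site, which makes the transported matrices intertwine the two tensors, and injectivity
makes them unitary up to a common scalar. The same argument gives uniqueness up to phases
(`IsInjectiveMPS.gauge_unique`), hence factor systems and one class for all bonds.

The second is translation. Shifting bond unitaries by one site replaces `(g_a, g_b)` by `(g_a ^ a,
g_b ^ b)`, so the class is invariant under this substitution. On an abelian group a class is
determined by its bimultiplicative commutator pairing, because `U(1)` is divisible and abelian
extensions by it split. Invariance then says that the sectors of the pairing are fixed by the powers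
`a²`, `ab` and `b²`.

The third concerns cyclic groups. The pure sectors are trivial there and the class is one `N`-th
root of unity, labelled by `k`; for `a = 1` the constraint reads `k (b - 1) = 0`. Conversely,
generalized Pauli matrices acting on maximally entangled pairs realize every such `k`, since the
modulation then does not change their action. -/

noncomputable section
namespace ModulatedMPS
open Matrix
open scoped Kronecker ComplexOrder
open Filter Topology

/-! ### Convergence of matrix powers. -/

section PowerConvergence

variable {n : Type*} [Fintype n] [DecidableEq n]

attribute [local instance] Matrix.linftyOpNormedRing Matrix.linftyOpNormedAlgebra in
/-- Powers of a complex matrix all of whose eigenvalues lie in the open unit disc tend to `0`. -/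
theorem tendsto_pow_zero_of_eigenvalues (M : Matrix n n ℂ)
    (h : ∀ μ : ℂ, Module.End.HasEigenvalue (Matrix.toLin' M) μ → ‖μ‖ < 1) :
    Tendsto (fun k => M ^ k) atTop (𝓝 0) := by
  have hs : spectralRadius ℂ M < 1 := by
    rcases (spectrum ℂ M).eq_empty_or_nonempty with he | hne
    · rw [spectralRadius, he]; simp
    · refine spectrum.spectralRadius_lt_of_forall_lt_of_nonempty hne (r := 1) fun μ hμ => ?_
      rw [← Matrix.spectrum_toLin', ← Module.End.hasEigenvalue_iff_mem_spectrum] at hμ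
      exact_mod_cast h μ hμ
  obtain ⟨r, hr, hr1⟩ := exists_between hs
  -- Gelfand's formula: eventually `‖M ^ k‖ ≤ r ^ k`, with `r < 1` above the spectral radius.
  have hlim := spectrum.pow_nnnorm_pow_one_div_tendsto_nhds_spectralRadius M
  have hev := hlim.eventually (gt_mem_nhds hr)
  refine tendsto_zero_iff_norm_tendsto_zero.2 ?_
  have hrtop : r ≠ ⊤ := (hr1.trans ENNReal.one_lt_top).ne
  lift r to NNReal using hrtop
  have hr1' : (r : ℝ) < 1 := by exact_mod_cast hr1
  refine squeeze_zero' (Eventually.of_forall fun _ => norm_nonneg _) ?_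
    (tendsto_pow_atTop_nhds_zero_of_lt_one r.2 hr1')
  filter_upwards [hev, eventually_gt_atTop 0] with k hk hk0
  have h2 : (‖M ^ k‖₊ : ENNReal) ≤ (r : ENNReal) ^ k := by
    have h3 := ENNReal.rpow_le_rpow hk.le (z := (k : ℝ)) (by positivity)
    rw [← ENNReal.rpow_mul, one_div, inv_mul_cancel₀ (by positivity), ENNReal.rpow_one,
      ENNReal.rpow_natCast] at h3
    exact h3
  exact_mod_cast h2

/-- A matrix with simple dominant eigenvalue `1`, right eigenvector `u` and left eigenvector `w`,
has powers converging to the rank-one projection onto `u` along `w`. -/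
theorem tendsto_pow_vecMulVec (M : Matrix n n ℂ) (u w : n → ℂ) (hu : M *ᵥ u = u)
    (hw : w ᵥ* M = w) (hwu : w ⬝ᵥ u = 1)
    (h1 : Module.finrank ℂ (Module.End.eigenspace (Matrix.toLin' M) 1) = 1)
    (hgap : ∀ μ : ℂ, Module.End.HasEigenvalue (Matrix.toLin' M) μ → μ ≠ 1 → ‖μ‖ < 1) :
    Tendsto (fun k => M ^ k) atTop (𝓝 (vecMulVec u w)) := by
  set P := vecMulVec u w with hP
  have hMP : M * P = P := by rw [hP, Matrix.mul_vecMulVec, hu]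
  have hPM : P * M = P := by rw [hP, Matrix.vecMulVec_mul, hw]
  have hPP : P * P = P := by
    rw [hP, Matrix.vecMulVec_mul_vecMulVec, hwu, one_smul]
  -- Deflation: `P` is idempotent and absorbs `M` on both sides. The exponent starts at `1` because
  -- the identity fails at `0`.
  have hpow : ∀ k, (M - P) ^ (k + 1) = M ^ (k + 1) - P := by
    intro k
    induction k with
    | zero => simp
    | succ k ih =>
      have hMkP : ∀ j, M ^ j * P = P := by
        intro j
        induction j with
        | zero => simp
        | succ j ih => rw [pow_succ, Matrix.mul_assoc, hMP, ih]
      rw [pow_succ, ih, sub_mul, mul_sub, mul_sub, hMkP, hPM, hPP, ← pow_succ]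
      abel
  have hlim := tendsto_pow_zero_of_eigenvalues (M - P) (fun μ hμ => ?_)
  · have h2 := ((tendsto_add_atTop_iff_nat 1).2 hlim).add_const P
    simp only [hpow, sub_add_cancel, zero_add] at h2
    exact (tendsto_add_atTop_iff_nat 1).1 h2
  · obtain ⟨x, hx⟩ := hμ.exists_hasEigenvector
    have hx0 := hx.2
    have hxe : (M - P) *ᵥ x = μ • x := hx.apply_eq_smul
    by_cases hμ0 : μ = 0
    · simp [hμ0]
    -- Since `w` annihilates `M - P` from the left, an eigenvector with `μ ≠ 0` lies in the kernel
    -- of `w`, so it is also an eigenvector of `M`.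
    have hwx : w ⬝ᵥ x = 0 := by
      have h3 : w ⬝ᵥ ((M - P) *ᵥ x) = 0 := by
        rw [Matrix.dotProduct_mulVec, Matrix.vecMul_sub, hw, hP, Matrix.vecMul_vecMulVec, hwu]
        simp
      rw [hxe, dotProduct_smul, smul_eq_mul] at h3
      exact (mul_eq_zero.1 h3).resolve_left hμ0
    have hMx : M *ᵥ x = μ • x := by
      rw [← hxe, Matrix.sub_mulVec, hP, Matrix.vecMulVec_mulVec, hwx]
      simp
    have hev : Module.End.HasEigenvalue (Matrix.toLin' M) μ :=
      Module.End.hasEigenvalue_of_hasEigenvector (x := x)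
        ⟨Module.End.mem_eigenspace_iff.2 (by simpa using hMx), hx0⟩
    -- If `μ = 1`, simplicity makes `x` a multiple of `u`, which `w` does not annihilate.
    refine hgap μ hev fun h1' => hx0 ?_
    subst h1'
    have hu0 : u ≠ 0 := by rintro rfl; simp at hwu
    have hmu : u ∈ Module.End.eigenspace (Matrix.toLin' M) 1 :=
      Module.End.mem_eigenspace_iff.2 (by simpa using hu)
    have hmx : x ∈ Module.End.eigenspace (Matrix.toLin' M) 1 :=
      Module.End.mem_eigenspace_iff.2 (by simpa using hMx)
    obtain ⟨c, hc⟩ := (finrank_eq_one_iff_of_nonzero' (⟨u, hmu⟩ : Module.End.eigenspace _ _)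
      (by simpa using hu0)).1 h1 ⟨x, hmx⟩
    have hc' : c • u = x := congrArg Subtype.val hc
    rw [← hc', dotProduct_smul, hwu] at hwx
    simp only [smul_eq_mul, mul_one] at hwx
    rw [← hc', hwx, zero_smul]

end PowerConvergence

/-! ### Ordered products along a chain. -/

section ListProducts

/-- Expansion of an ordered product of sums. -/
theorem prod_ofFn_sum {R σ : Type*} [Semiring R] [Fintype σ] {n : ℕ} (f : Fin n → σ → R) :
    (List.ofFn fun i => ∑ s, f i s).prod = ∑ s : Fin n → σ, (List.ofFn fun i => f i (s i)).prod := by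
  induction n with
  | zero => simp
  | succ n ih =>
    rw [List.ofFn_succ, List.prod_cons, ih, Finset.sum_mul_sum,
      ← (Fin.consEquiv fun _ : Fin (n + 1) => σ).sum_comp, Fintype.sum_prod_type]
    simp [Fin.consEquiv, List.ofFn_succ]

theorem prod_ofFn_smul {R S : Type*} [CommSemiring S] [Semiring R] [Algebra S R] {n : ℕ}
    (c : Fin n → S) (f : Fin n → R) :
    (List.ofFn fun i => c i • f i).prod = (∏ i, c i) • (List.ofFn f).prod := by
  induction n with
  | zero => simp
  | succ n ih =>
    simp only [List.ofFn_succ, List.prod_cons, ih, Fin.prod_univ_succ, smul_mul_smul_comm]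

theorem prod_ofFn_kronecker {m p : Type*} [Fintype m] [Fintype p] [DecidableEq m] [DecidableEq p]
    {n : ℕ} (f : Fin n → Matrix m m ℂ) (g : Fin n → Matrix p p ℂ) :
    (List.ofFn fun i => f i ⊗ₖ g i).prod = (List.ofFn f).prod ⊗ₖ (List.ofFn g).prod := by
  induction n with
  | zero => simp
  | succ n ih => simp only [List.ofFn_succ, List.prod_cons, ih, mul_kronecker_mul]

theorem prod_ofFn_map_conj {m : Type*} [Fintype m] [DecidableEq m]
    {n : ℕ} (f : Fin n → Matrix m m ℂ) :
    (List.ofFn fun i => (f i).map (starRingEnd ℂ)).prod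
      = (List.ofFn f).prod.map (starRingEnd ℂ) := by
  induction n with
  | zero => simp
  | succ n ih => simp only [List.ofFn_succ, List.prod_cons, ih, Matrix.map_mul]

theorem prod_ofFn_periodic {R : Type*} [Monoid R] {L : ℕ} [NeZero L] (k : ℕ) (f : ℕ → R) :
    (List.ofFn fun i : Fin (k * L) => f (i.val % L)).prod
      = (List.ofFn fun i : Fin L => f i.val).prod ^ k := by
  rw [List.ofFn_mul, List.prod_flatten]
  have h : ∀ (i : Fin k) (j : Fin L), (i.val * L + j.val) % L = j.val := fun i j => by
    rw [Nat.add_comm, Nat.add_mul_mod_self_right, Nat.mod_eq_of_lt j.2]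
  simp [h, List.ofFn_const]

theorem prod_ofFn_const {R : Type*} [Monoid R] (n : ℕ) (x : R) :
    (List.ofFn fun _ : Fin n => x).prod = x ^ n := by
  simp [List.ofFn_const]

theorem prod_ofFn_val_succ {R : Type*} [Monoid R] (n : ℕ) (f : ℕ → R) :
    (List.ofFn fun i : Fin (n + 1) => f i.val).prod
      = (List.ofFn fun i : Fin n => f i.val).prod * f n := by
  rw [List.ofFn_succ']; simp

end ListProducts

end ModulatedMPS
end

noncomputable section
namespace ModulatedMPS
open Matrix
open scoped Kronecker ComplexOrder
open Filter Topology

/-! ### Mixed transfer matrices and their action on bond matrices. -/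

section TransferMaps

variable {d χ : ℕ}

/-- The action of an on-site matrix on the physical index of a tensor. -/
def siteAct (W : Matrix (Fin d) (Fin d) ℂ) (A : Fin d → Matrix (Fin χ) (Fin χ) ℂ) (s : Fin d) :
    Matrix (Fin χ) (Fin χ) ℂ :=
  ∑ s', W s s' • A s'

/-- The mixed transfer matrix of two tensors. -/
def mixedTransfer (B A : Fin d → Matrix (Fin χ) (Fin χ) ℂ) :
    Matrix (Fin χ × Fin χ) (Fin χ × Fin χ) ℂ :=
  ∑ s, B s ⊗ₖ (A s).map (starRingEnd ℂ)

/-- The transposed mixed transfer matrix, as a map on matrices. -/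
def dualTransfer (A B : Fin d → Matrix (Fin χ) (Fin χ) ℂ) (Y : Matrix (Fin χ) (Fin χ) ℂ) :
    Matrix (Fin χ) (Fin χ) ℂ :=
  ∑ s, (A s)ᴴ * Y * B s

/-- The transpose carries a bond matrix from left to right along the chain; for `B = A` its fixed
point is the identity, by left canonicity. -/
theorem mixedTransfer_transpose_mulVec_vec (A B : Fin d → Matrix (Fin χ) (Fin χ) ℂ)
    (Y : Matrix (Fin χ) (Fin χ) ℂ) :
    (mixedTransfer B A)ᵀ *ᵥ vec Y = vec (dualTransfer A B Y) := by
  simp only [mixedTransfer, dualTransfer, Matrix.transpose_sum, Matrix.sum_mulVec, vec_sum]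
  refine Finset.sum_congr rfl fun s _ => ?_
  have h : (B s ⊗ₖ (A s).map (starRingEnd ℂ))ᵀ = (B s)ᵀ ⊗ₖ (A s)ᴴ := by
    ext i j
    simp [Matrix.kroneckerMap_apply, Matrix.conjTranspose_apply]
  rw [h, kronecker_mulVec_vec, Matrix.transpose_transpose]

theorem dualTransfer_smul (A B : Fin d → Matrix (Fin χ) (Fin χ) ℂ) (c : ℂ)
    (Y : Matrix (Fin χ) (Fin χ) ℂ) :
    dualTransfer A B (c • Y) = c • dualTransfer A B Y := by
  simp [dualTransfer, Finset.smul_sum]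

theorem siteAct_smul (W : Matrix (Fin d) (Fin d) ℂ) (c : ℂ)
    (A : Fin d → Matrix (Fin χ) (Fin χ) ℂ) (s : Fin d) :
    siteAct W (fun s => c • A s) s = c • siteAct W A s := by
  simp only [siteAct, Finset.smul_sum]
  exact Finset.sum_congr rfl fun _ _ => smul_comm _ _ _

theorem siteAct_mul_mul (W : Matrix (Fin d) (Fin d) ℂ) (X Y : Matrix (Fin χ) (Fin χ) ℂ)
    (A : Fin d → Matrix (Fin χ) (Fin χ) ℂ) (s : Fin d) :
    siteAct W (fun s => X * A s * Y) s = X * siteAct W A s * Y := by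
  simp [siteAct, Finset.mul_sum, Finset.sum_mul]

theorem siteAct_siteAct (W V : Matrix (Fin d) (Fin d) ℂ)
    (A : Fin d → Matrix (Fin χ) (Fin χ) ℂ) (s : Fin d) :
    siteAct W (siteAct V A) s = siteAct (W * V) A s := by
  simp only [siteAct, Finset.smul_sum, Matrix.mul_apply, Finset.sum_smul, smul_smul]
  rw [Finset.sum_comm]

/-- Each entry of the transfer matrix is an inner product over the physical index, which a unitary
preserves. -/
theorem mixedTransfer_siteAct_self (W : unitaryGroup (Fin d) ℂ)
    (A : Fin d → Matrix (Fin χ) (Fin χ) ℂ) :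
    mixedTransfer (siteAct W.1 A) (siteAct W.1 A) = transferMatrix A := by
  ext ⟨i, k⟩ ⟨j, l⟩
  have h : ∀ x y : Fin d → ℂ, star (W.1 *ᵥ y) ⬝ᵥ (W.1 *ᵥ x) = star y ⬝ᵥ x := fun x y => by
    rw [Matrix.star_mulVec, Matrix.dotProduct_mulVec, Matrix.vecMul_vecMul,
      ← Matrix.star_eq_conjTranspose, Unitary.coe_star_mul_self W, Matrix.vecMul_one]
  have h2 := h (fun s => A s i j) (fun s => A s k l)
  simp only [dotProduct, mulVec, Pi.star_apply] at h2
  simp only [mixedTransfer, transferMatrix, Matrix.sum_apply, Matrix.kroneckerMap_apply,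
    Matrix.map_apply, siteAct, Matrix.smul_apply, smul_eq_mul]
  simpa only [mul_comm, starRingEnd_apply] using h2

theorem dualTransfer_eq_of_mixedTransfer_eq {A B : Fin d → Matrix (Fin χ) (Fin χ) ℂ}
    (h : mixedTransfer B B = transferMatrix A) (Y : Matrix (Fin χ) (Fin χ) ℂ) :
    dualTransfer B B Y = dualTransfer A A Y := by
  rw [← vec_inj, ← mixedTransfer_transpose_mulVec_vec, h, ← mixedTransfer_transpose_mulVec_vec]
  rfl

theorem transferMatrix_transpose_pow_mulVec_vec (A : Fin d → Matrix (Fin χ) (Fin χ) ℂ) (k : ℕ)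
    (Y : Matrix (Fin χ) (Fin χ) ℂ) :
    (transferMatrix A)ᵀ ^ k *ᵥ vec Y = vec ((dualTransfer A A)^[k] Y) := by
  induction k generalizing Y with
  | zero => simp
  | succ k ih =>
    rw [pow_succ, ← Matrix.mulVec_mulVec, Function.iterate_succ_apply, ← ih]
    congr 1
    exact mixedTransfer_transpose_mulVec_vec A A Y

end TransferMaps

/-! ### Spectral consequences of injectivity. -/

section Injective

variable {d χ : ℕ} {A : Fin d → Matrix (Fin χ) (Fin χ) ℂ}

theorem IsInjectiveMPS.nonempty (hA : IsInjectiveMPS A) : Nonempty (Fin χ) := by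
  by_contra h
  rw [not_nonempty_iff] at h
  have := hA.unique_dominant
  have h2 : Subsingleton (Module.End.eigenspace (Matrix.toLin' (transferMatrix A)) 1) :=
    inferInstance
  rw [Module.finrank_zero_of_subsingleton] at this
  exact zero_ne_one this

theorem IsInjectiveMPS.exists_ne_zero (hA : IsInjectiveMPS A) : ∃ s, A s ≠ 0 := by
  by_contra! h
  have := hA.nonempty
  have h1 := hA.left_canonical
  simp [h] at h1

/-- The powers of the transfer matrix of an injective tensor converge to the projection onto the
normalized right fixed point along the identity. -/
theorem IsInjectiveMPS.exists_tendsto (hA : IsInjectiveMPS A) :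
    ∃ ρ : Matrix (Fin χ) (Fin χ) ℂ, ρ.PosDef ∧ ρ.trace = 1 ∧
      ∑ s, A s * ρ * (A s)ᴴ = ρ ∧
      Tendsto (fun k => transferMatrix A ^ k) atTop (𝓝 (vecMulVec (vec ρᵀ) (vec 1))) := by
  obtain ⟨σ, hσ, hfix⟩ := hA.right_fixed
  have := hA.nonempty
  have htr : 0 < σ.trace := hσ.trace_pos
  set ρ := (σ.trace)⁻¹ • σ with hρ
  have hρpos : ρ.PosDef := hσ.smul (inv_pos.2 htr)
  have hρtr : ρ.trace = 1 := by
    rw [hρ, Matrix.trace_smul, smul_eq_mul, inv_mul_cancel₀ htr.ne']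
  have hρfix : ∑ s, A s * ρ * (A s)ᴴ = ρ := by
    have h : ∑ s, A s * ρ * (A s)ᴴ = (σ.trace)⁻¹ • ∑ s, A s * σ * (A s)ᴴ := by
      simp [hρ, Finset.smul_sum]
    rw [h, hfix]
  refine ⟨ρ, hρpos, hρtr, hρfix, tendsto_pow_vecMulVec _ _ _ ?_ ?_ ?_ hA.unique_dominant hA.gap⟩
  -- `vec` stacks columns, so the right fixed point enters transposed.
  · rw [transferMatrix, Matrix.sum_mulVec]
    conv_rhs => rw [← hρfix, Matrix.transpose_sum, vec_sum]
    refine Finset.sum_congr rfl fun s _ => ?_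
    rw [kronecker_mulVec_vec, Matrix.transpose_mul, Matrix.transpose_mul, ← Matrix.mul_assoc]
    congr 2
  · have h := mixedTransfer_transpose_mulVec_vec A A 1
    rw [Matrix.mulVec_transpose] at h
    refine h.trans ?_
    rw [dualTransfer]
    simp [hA.left_canonical]
  · rw [vec_dotProduct_vec]
    simp [hρtr]

/-- The rank-one limit has trace `tr ρ = 1`. This trace is the squared norm of the periodic state.
-/
theorem IsInjectiveMPS.tendsto_trace_pow (hA : IsInjectiveMPS A) :
    Tendsto (fun k => (transferMatrix A ^ k).trace) atTop (𝓝 1) := by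
  obtain ⟨ρ, -, htr, -, hlim⟩ := hA.exists_tendsto
  have h := ((Continuous.matrix_trace continuous_id).tendsto _).comp hlim
  have h2 : (vecMulVec (vec ρᵀ) (vec (1 : Matrix (Fin χ) (Fin χ) ℂ))).trace = 1 := by
    rw [Matrix.trace_vecMulVec, vec_dotProduct_vec]
    simp [htr]
  rw [id, h2] at h
  exact h

/-- An eigenvector of a power of the dual transfer map with unimodular eigenvalue is scalar. -/
theorem IsInjectiveMPS.eq_smul_one (hA : IsInjectiveMPS A) {L : ℕ} (hL : 0 < L)
    {X : Matrix (Fin χ) (Fin χ) ℂ} {θ : ℂ} (hθ : ‖θ‖ = 1)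
    (hX : (dualTransfer A A)^[L] X = θ • X) : ∃ z : ℂ, X = z • 1 := by
  obtain ⟨ρ, -, -, -, hlim⟩ := hA.exists_tendsto
  have hiter : ∀ k, (dualTransfer A A)^[L * k] X = θ ^ k • X := by
    intro k
    induction k with
    | zero => simp
    | succ k ih =>
      have hsm : ∀ (j : ℕ) (c : ℂ) Y,
          (dualTransfer A A)^[j] (c • Y) = c • (dualTransfer A A)^[j] Y := by
        intro j c Y
        induction j generalizing Y with
        | zero => rfl
        | succ j ihj => rw [Function.iterate_succ_apply, dualTransfer_smul, ihj,
            Function.iterate_succ_apply]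
      rw [Nat.mul_succ, Function.iterate_add_apply, hX, hsm, ih, smul_smul, pow_succ']
  -- The multiples `θ ^ k • X` converge to a multiple of the identity.
  have hlim2 : Tendsto (fun k : ℕ => θ ^ k • vec X) atTop
      (𝓝 ((vec ρᵀ ⬝ᵥ vec X) • vec 1)) := by
    have h1 : Continuous fun M : Matrix (Fin χ × Fin χ) (Fin χ × Fin χ) ℂ => Mᵀ *ᵥ vec X := by
      fun_prop
    have h2 := ((h1.tendsto _).comp hlim).comp (tendsto_id.const_mul_atTop' hL)
    rw [Matrix.transpose_vecMulVec, Matrix.vecMulVec_mulVec] at h2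
    convert h2 using 2 with k
    · simp only [Function.comp, id]
      rw [Matrix.transpose_pow, transferMatrix_transpose_pow_mulVec_vec, hiter, vec_smul]
    · ext; simp [mul_comm]
  set t := vec ρᵀ ⬝ᵥ vec X
  have hent : ∀ i j, Tendsto (fun k : ℕ => θ ^ k * X i j) atTop
      (𝓝 (t * (1 : Matrix (Fin χ) (Fin χ) ℂ) i j)) := fun i j => by
    have := (tendsto_pi_nhds.1 hlim2) (j, i)
    simpa [vec] using this
  -- As `‖θ‖ = 1`, nothing decays: off-diagonal entries and differences of diagonal entries, whose
  -- limits are `0`, must vanish.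
  have hvan : ∀ x : ℂ, Tendsto (fun k : ℕ => θ ^ k * x) atTop (𝓝 0) → x = 0 := fun x hx => by
    have h3 := hx.norm
    simp only [norm_mul, norm_pow, hθ, one_pow, one_mul, norm_zero] at h3
    exact norm_eq_zero.1 (tendsto_nhds_unique tendsto_const_nhds h3)
  obtain ⟨i₀⟩ := hA.nonempty
  refine ⟨X i₀ i₀, ?_⟩
  ext i j
  by_cases hij : i = j
  · subst hij
    have h4 := (hent i i).sub (hent i₀ i₀)
    simp only [Matrix.one_apply_eq, sub_self, ← mul_sub] at h4
    simpa using sub_eq_zero.1 (hvan _ h4)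
  · have h5 := hent i j
    rw [Matrix.one_apply_ne hij, mul_zero] at h5
    simp [hij, hvan _ h5]

end Injective

end ModulatedMPS
end

noncomputable section
namespace ModulatedMPS
open Matrix
open scoped Kronecker ComplexOrder
open Filter Topology

/-! ### Overlaps and transport around the ring. -/

section Bonds

variable {d χ : ℕ}

/-- The inner product of the amplitudes of two families of tensors on a ring is the trace of the
product of their mixed transfer matrices. -/
theorem sum_trace_mul_conj_trace {n : ℕ} (B : Fin n → Fin d → Matrix (Fin χ) (Fin χ) ℂ)
    (A : Fin d → Matrix (Fin χ) (Fin χ) ℂ) :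
    ∑ s : Fin n → Fin d, (List.ofFn fun i => B i (s i)).prod.trace
        * starRingEnd ℂ (mpsState A n s)
      = (List.ofFn fun i => mixedTransfer (B i) A).prod.trace := by
  simp only [mixedTransfer, prod_ofFn_sum, Matrix.trace_sum, prod_ofFn_kronecker,
    Matrix.trace_kronecker]
  refine Finset.sum_congr rfl fun s _ => ?_
  rw [prod_ofFn_map_conj (fun i => A (s i)), mpsState]
  congr 1
  simp [Matrix.trace]

/-- Acting with on-site matrices on an MPS acts on the tensors. -/
theorem sum_prod_mul_mpsState {n : ℕ} (W : Fin n → Matrix (Fin d) (Fin d) ℂ)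
    (A : Fin d → Matrix (Fin χ) (Fin χ) ℂ) (s : Fin n → Fin d) :
    ∑ s' : Fin n → Fin d, (∏ i, W i (s i) (s' i)) * mpsState A n s'
      = (List.ofFn fun i => siteAct (W i) A (s i)).prod.trace := by
  simp only [siteAct, prod_ofFn_sum, Matrix.trace_sum]
  refine Finset.sum_congr rfl fun s' _ => ?_
  rw [prod_ofFn_smul (fun i => W i (s i) (s' i)) (fun i => A (s' i)), Matrix.trace_smul, mpsState,
    smul_eq_mul]

/-- The sequence obtained by transporting `Y` along the mixed dual transfer maps. -/
def transport (A : Fin d → Matrix (Fin χ) (Fin χ) ℂ)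
    (B : ℕ → Fin d → Matrix (Fin χ) (Fin χ) ℂ) (Y : Matrix (Fin χ) (Fin χ) ℂ) :
    ℕ → Matrix (Fin χ) (Fin χ) ℂ
  | 0 => Y
  | n + 1 => dualTransfer A (B n) (transport A B Y n)

theorem vec_transport (A : Fin d → Matrix (Fin χ) (Fin χ) ℂ)
    (B : ℕ → Fin d → Matrix (Fin χ) (Fin χ) ℂ) (Y : Matrix (Fin χ) (Fin χ) ℂ) (n : ℕ) :
    vec (transport A B Y n)
      = (List.ofFn fun i : Fin n => mixedTransfer (B i.val) A).prodᵀ *ᵥ vec Y := by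
  induction n with
  | zero => simp [transport]
  | succ n ih =>
    rw [prod_ofFn_val_succ n fun i => mixedTransfer (B i) A, Matrix.transpose_mul,
      ← Matrix.mulVec_mulVec, ← ih, mixedTransfer_transpose_mulVec_vec, transport]

/-- If the overlaps do not decay, the blocked mixed transfer map has an eigenvalue outside the open
unit disc. -/
theorem exists_transport_eigenvector {A : Fin d → Matrix (Fin χ) (Fin χ) ℂ}
    (hA : IsInjectiveMPS A) {L : ℕ} [NeZero L] (B : ℕ → Fin d → Matrix (Fin χ) (Fin χ) ℂ)
    (h : ∀ k, 0 < k → ∃ θ : Circle, ∀ s : Fin (k * L) → Fin d,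
      (List.ofFn fun i : Fin (k * L) => B (i.val % L) (s i)).prod.trace
        = (θ : ℂ) * mpsState A (k * L) s) :
    ∃ (Y : Matrix (Fin χ) (Fin χ) ℂ) (μ : ℂ), Y ≠ 0 ∧ 1 ≤ ‖μ‖ ∧ transport A B Y L = μ • Y := by
  set M := (List.ofFn fun i : Fin L => mixedTransfer (B i.val) A).prod with hM
  have hnorm : ∀ k, 0 < k → ‖(M ^ k).trace‖ = ‖(transferMatrix A ^ (k * L)).trace‖ := by
    intro k hk
    obtain ⟨θ, hθ⟩ := h k hk
    have h1 := sum_trace_mul_conj_trace (fun i : Fin (k * L) => B (i.val % L)) A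
    have h2 := sum_trace_mul_conj_trace (fun _ : Fin (k * L) => A) A
    simp only [hθ, mul_assoc] at h1
    rw [← Finset.mul_sum, prod_ofFn_periodic k (fun i => mixedTransfer (B i) A), ← hM] at h1
    rw [prod_ofFn_const] at h2
    rw [← h1]
    change _ = ‖(mixedTransfer A A ^ (k * L)).trace‖
    rw [← h2, norm_mul, Circle.norm_coe, one_mul]
    rfl
  -- Otherwise `tr (M ^ k)` would tend to `0`, while its modulus tends to `1`.
  have hex : ∃ μ, Module.End.HasEigenvalue (Matrix.toLin' Mᵀ) μ ∧ 1 ≤ ‖μ‖ := by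
    by_contra! hlt
    have h0 := ((Continuous.matrix_trace continuous_id).tendsto _).comp
      (tendsto_pow_zero_of_eigenvalues Mᵀ hlt)
    have h1 := (hA.tendsto_trace_pow.comp (tendsto_id.atTop_mul_const' (NeZero.pos L))).norm
    have h0' := h0.norm
    have h2 : (fun k => ‖(transferMatrix A ^ (k * L)).trace‖) =ᶠ[atTop]
        fun k => ‖(Mᵀ ^ k).trace‖ := by
      filter_upwards [eventually_gt_atTop 0] with k hk
      rw [← hnorm k hk, ← Matrix.transpose_pow, Matrix.trace_transpose]
    have h3 := tendsto_nhds_unique (h1.congr' h2) h0'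
    simp at h3
  obtain ⟨μ, hμ, hμ1⟩ := hex
  obtain ⟨x, hx⟩ := hμ.exists_hasEigenvector
  obtain ⟨Y, rfl⟩ := vec_bijective.2 x
  refine ⟨Y, μ, fun h0 => hx.2 (by simp [h0]), hμ1, ?_⟩
  rw [← vec_inj, vec_transport, vec_smul]
  exact hx.apply_eq_smul

/-- When the square is expanded, both cross terms and, by left canonicity, the last term equal `Zᴴ *
Z` for `Z = dualTransfer A B Y`. The loss in a transport step is thus a sum of squares that vanishes
only if `Y` and `Z` intertwine `B` with `A`. -/
theorem sum_conjTranspose_sub_mul_sub {A B : Fin d → Matrix (Fin χ) (Fin χ) ℂ}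
    (hA : ∑ s, (A s)ᴴ * A s = 1) (Y : Matrix (Fin χ) (Fin χ) ℂ) :
    ∑ s, (Y * B s - A s * dualTransfer A B Y)ᴴ * (Y * B s - A s * dualTransfer A B Y)
      = dualTransfer B B (Yᴴ * Y) - (dualTransfer A B Y)ᴴ * dualTransfer A B Y := by
  set Z := dualTransfer A B Y with hZ
  have h1 : ∑ s, (B s)ᴴ * Yᴴ * A s * Z = Zᴴ * Z := by
    rw [← Finset.sum_mul]
    congr 1
    rw [hZ, dualTransfer, Matrix.conjTranspose_sum]
    exact Finset.sum_congr rfl fun s _ => by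
      simp [Matrix.conjTranspose_mul, Matrix.mul_assoc]
  have h2 : ∑ s, Zᴴ * (A s)ᴴ * Y * B s = Zᴴ * Z := by
    conv_rhs => rw [hZ, dualTransfer, Finset.mul_sum, ← dualTransfer, ← hZ]
    exact Finset.sum_congr rfl fun s _ => by simp only [Matrix.mul_assoc]
  have h3 : ∑ s, Zᴴ * (A s)ᴴ * A s * Z = Zᴴ * Z := by
    simp only [Matrix.mul_assoc Zᴴ]
    rw [← Finset.mul_sum, ← Finset.sum_mul, hA, Matrix.one_mul]
  have h4 : ∑ s, (B s)ᴴ * Yᴴ * Y * B s = dualTransfer B B (Yᴴ * Y) := by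
    simp only [dualTransfer, Matrix.mul_assoc]
  have h5 : ∀ s, (Y * B s - A s * Z)ᴴ * (Y * B s - A s * Z)
      = (B s)ᴴ * Yᴴ * Y * B s - (B s)ᴴ * Yᴴ * A s * Z - Zᴴ * (A s)ᴴ * Y * B s
        + Zᴴ * (A s)ᴴ * A s * Z := fun s => by
    rw [Matrix.conjTranspose_sub, Matrix.conjTranspose_mul, Matrix.conjTranspose_mul]
    noncomm_ring
  rw [Finset.sum_congr rfl fun s _ => h5 s, Finset.sum_add_distrib, Finset.sum_sub_distrib,
    Finset.sum_sub_distrib, h1, h2, h3, h4]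
  abel

/-- Cyclicity of the trace moves the map onto its fixed point `ρ`. -/
theorem trace_mul_dualTransfer {A : Fin d → Matrix (Fin χ) (Fin χ) ℂ}
    {ρ : Matrix (Fin χ) (Fin χ) ℂ} (hρ : ∑ s, A s * ρ * (A s)ᴴ = ρ)
    (X : Matrix (Fin χ) (Fin χ) ℂ) :
    (ρ * dualTransfer A A X).trace = (ρ * X).trace := by
  conv_rhs => rw [← hρ]
  simp only [dualTransfer, Finset.mul_sum, Finset.sum_mul, Matrix.trace_sum]
  refine Finset.sum_congr rfl fun s _ => ?_
  rw [Matrix.mul_assoc (A s * ρ), Matrix.mul_assoc (A s), Matrix.trace_mul_comm (A s)]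
  simp only [Matrix.mul_assoc]

theorem trace_mul_conjTranspose_mul_self_nonneg {ρ : Matrix (Fin χ) (Fin χ) ℂ} (hρ : ρ.PosDef)
    (D : Matrix (Fin χ) (Fin χ) ℂ) : 0 ≤ (ρ * (Dᴴ * D)).trace := by
  rw [← Matrix.mul_assoc, Matrix.trace_mul_comm, ← Matrix.mul_assoc]
  exact (hρ.posSemidef.mul_mul_conjTranspose_same D).trace_nonneg

/-- The diagonal entries of `D * ρ * Dᴴ` are the values of a positive definite form on the
conjugated rows of `D`. -/
theorem eq_zero_of_trace_mul_conjTranspose_mul_self {ρ : Matrix (Fin χ) (Fin χ) ℂ}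
    (hρ : ρ.PosDef) {D : Matrix (Fin χ) (Fin χ) ℂ} (h : (ρ * (Dᴴ * D)).trace = 0) : D = 0 := by
  rw [← Matrix.mul_assoc, Matrix.trace_mul_comm, ← Matrix.mul_assoc,
    (hρ.posSemidef.mul_mul_conjTranspose_same D).trace_eq_zero_iff] at h
  ext i j
  by_contra hij
  have h1 : star (D i) ≠ 0 := fun h0 => hij (by simpa using congrFun h0 j)
  have h2 := hρ.dotProduct_mulVec_pos h1
  have h3 : (D * ρ * Dᴴ) i i = star (star (D i)) ⬝ᵥ (ρ *ᵥ star (D i)) := by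
    rw [Matrix.mul_assoc, Matrix.mul_apply, star_star]
    simp only [dotProduct, mulVec, Matrix.mul_apply, Matrix.conjTranspose_apply, Pi.star_apply]
  rw [← h3, h] at h2
  simp at h2

end Bonds

end ModulatedMPS
end

noncomputable section
namespace ModulatedMPS
open Matrix
open scoped Kronecker ComplexOrder
open Filter Topology

/-! ### Intertwiners and unitary gauges. -/

section Bonds

variable {d χ : ℕ}

/-- A transported eigenvector with eigenvalue outside the open unit disc intertwines the tensors. -/
theorem transport_intertwines {A : Fin d → Matrix (Fin χ) (Fin χ) ℂ}
    (hA : IsInjectiveMPS A) {L : ℕ} (B : ℕ → Fin d → Matrix (Fin χ) (Fin χ) ℂ)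
    (hB : ∀ j, mixedTransfer (B j) (B j) = transferMatrix A)
    {Y : Matrix (Fin χ) (Fin χ) ℂ} {μ : ℂ} (hY : Y ≠ 0) (hμ : 1 ≤ ‖μ‖)
    (hL : transport A B Y L = μ • Y) :
    ‖μ‖ = 1 ∧ ∀ j < L, ∀ s, transport A B Y j * B j s = A s * transport A B Y (j + 1) := by
  obtain ⟨ρ, hρ, -, hfix, -⟩ := hA.exists_tendsto
  set T := transport A B Y with hT
  set q : ℕ → ℂ := fun j => (ρ * ((T j)ᴴ * T j)).trace with hq
  set D : ℕ → Fin d → Matrix (Fin χ) (Fin χ) ℂ := fun j s => T j * B j s - A s * T (j + 1) with hD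
  -- The weighted norm `q` drops at each site by the weighted size of the intertwining defect `D`.
  have hstep : ∀ j, q j - q (j + 1) = ∑ s, (ρ * ((D j s)ᴴ * D j s)).trace := by
    intro j
    have h1 := sum_conjTranspose_sub_mul_sub (B := B j) hA.left_canonical (T j)
    rw [dualTransfer_eq_of_mixedTransfer_eq (hB j)] at h1
    rw [← Matrix.trace_sum, ← Finset.mul_sum]
    change _ = (ρ * ∑ s, (T j * B j s - A s * dualTransfer A (B j) (T j))ᴴ
      * (T j * B j s - A s * dualTransfer A (B j) (T j))).trace
    rw [h1, Matrix.mul_sub, Matrix.trace_sub, trace_mul_dualTransfer hfix]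
    rfl
  have hnn : ∀ j s, 0 ≤ (ρ * ((D j s)ᴴ * D j s)).trace := fun j s =>
    trace_mul_conjTranspose_mul_self_nonneg hρ _
  have hanti : Antitone q := antitone_nat_of_succ_le fun j => by
    rw [← sub_nonneg, hstep]
    exact Finset.sum_nonneg fun s _ => hnn j s
  -- One turn multiplies `q` by `‖μ‖ ^ 2 ≥ 1`, yet `q` is antitone and positive at `0`. So `‖μ‖ =
  -- 1`, `q` is constant up to `L`, and every defect there vanishes.
  have hqL : q L = (‖μ‖ ^ 2 : ℝ) * q 0 := by
    have h1 : T 0 = Y := rfl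
    simp only [hq, hL, h1, Matrix.conjTranspose_smul, Matrix.smul_mul, Matrix.mul_smul,
      Matrix.trace_smul, smul_smul, smul_eq_mul]
    congr 1
    rw [mul_comm, ← Complex.normSq_eq_norm_sq, ← Complex.mul_conj, mul_comm]
    simp
  have hq0 : 0 ≤ q 0 := trace_mul_conjTranspose_mul_self_nonneg hρ _
  have hq0' : q 0 ≠ 0 := fun h => hY (eq_zero_of_trace_mul_conjTranspose_mul_self hρ h)
  have hq0r : 0 < (q 0).re := (Complex.pos_iff.1 (lt_of_le_of_ne hq0 hq0'.symm)).1
  have hqLr : (q L).re = ‖μ‖ ^ 2 * (q 0).re := by rw [hqL, Complex.re_ofReal_mul]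
  have hqL0 : (q L).re ≤ (q 0).re := (Complex.le_def.1 (hanti (Nat.zero_le L))).1
  have hμ1 : ‖μ‖ = 1 := by
    refine le_antisymm ?_ hμ
    by_contra! hlt
    nlinarith [mul_pos hq0r (by nlinarith : (0 : ℝ) < ‖μ‖ ^ 2 - 1)]
  refine ⟨hμ1, fun j hj s => ?_⟩
  have hqeq : q L = q 0 := by rw [hqL, hμ1]; simp
  have h1 : q j - q (j + 1) = 0 := by
    refine le_antisymm ?_ (sub_nonneg.2 (hanti (Nat.le_succ j)))
    rw [sub_nonpos]
    exact (hanti (Nat.zero_le j)).trans (hqeq.symm.le.trans (hanti hj))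
  rw [hstep] at h1
  have h2 := (Finset.sum_eq_zero_iff_of_nonneg fun s _ => hnn j s).1 h1 s (Finset.mem_univ s)
  exact sub_eq_zero.1 (eq_zero_of_trace_mul_conjTranspose_mul_self hρ h2)

/-- Tensors on a ring whose states agree with the MPS up to phases are gauge equivalent to it by
unitaries on the bonds. -/
theorem exists_unitary_gauge {A : Fin d → Matrix (Fin χ) (Fin χ) ℂ}
    (hA : IsInjectiveMPS A) {L : ℕ} [NeZero L] (B : ℕ → Fin d → Matrix (Fin χ) (Fin χ) ℂ)
    (hB : ∀ j, mixedTransfer (B j) (B j) = transferMatrix A)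
    (h : ∀ k, 0 < k → ∃ θ : Circle, ∀ s : Fin (k * L) → Fin d,
      (List.ofFn fun i : Fin (k * L) => B (i.val % L) (s i)).prod.trace
        = (θ : ℂ) * mpsState A (k * L) s) :
    ∃ v : Fin L → unitaryGroup (Fin χ) ℂ, ∀ i : Fin L, ∃ θ : Circle, ∀ s,
      B i s = (θ : ℂ) • ((v i : Matrix (Fin χ) (Fin χ) ℂ)ᴴ * A s
        * (v (i + 1) : Matrix (Fin χ) (Fin χ) ℂ)) := by
  obtain ⟨Y, μ, hY, hμ, hL⟩ := exists_transport_eigenvector hA B h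
  obtain ⟨hμ1, hint⟩ := transport_intertwines hA B hB hY hμ hL
  set T := transport A B Y with hT
  -- The intertwining relation makes the Gram matrices evolve under the dual transfer map of `A`
  -- alone. Since `‖μ‖ = 1` they return after one turn, hence are scalar.
  have hgram : ∀ j ≤ L, (T j)ᴴ * T j = (dualTransfer A A)^[j] (Yᴴ * Y) := by
    intro j
    induction j with
    | zero => intro _; rfl
    | succ j ih =>
      intro hj
      rw [Function.iterate_succ_apply', ← ih (by omega),
        ← dualTransfer_eq_of_mixedTransfer_eq (hB j)]
      have h1 : (T (j + 1))ᴴ = ∑ s, (B j s)ᴴ * (T j)ᴴ * A s := by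
        change (∑ s, (A s)ᴴ * T j * B j s)ᴴ = _
        simp [Matrix.conjTranspose_sum, Matrix.mul_assoc]
      rw [h1, Finset.sum_mul, dualTransfer]
      refine Finset.sum_congr rfl fun s _ => ?_
      simp only [Matrix.mul_assoc]
      rw [← hint j hj s]
  have hfix : (dualTransfer A A)^[L] (Yᴴ * Y) = (1 : ℂ) • (Yᴴ * Y) := by
    rw [← hgram L le_rfl, hL, Matrix.conjTranspose_smul, smul_mul_smul_comm]
    congr 1
    rw [Complex.star_def, ← Complex.normSq_eq_conj_mul_self, Complex.normSq_eq_norm_sq, hμ1]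
    simp
  obtain ⟨z, hz⟩ := hA.eq_smul_one (NeZero.pos L) (by simp) hfix
  have hgram' : ∀ j ≤ L, (T j)ᴴ * T j = z • 1 := by
    intro j hj
    rw [hgram j hj, hz]
    clear hj
    induction j with
    | zero => rfl
    | succ j ih =>
      rw [Function.iterate_succ_apply', ih, dualTransfer_smul, dualTransfer]
      simp [hA.left_canonical]
  have hne := hA.nonempty
  have hz0 : 0 < z := by
    obtain ⟨i⟩ := hne
    have h1 : 0 ≤ z := by
      have h2 := (Matrix.posSemidef_conjTranspose_mul_self Y).diag_nonneg (i := i)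
      rw [hz] at h2
      simpa using h2
    refine lt_of_le_of_ne h1 fun h0 => hY ?_
    rw [← h0, zero_smul] at hz
    exact Matrix.conjTranspose_mul_self_eq_zero.1 hz
  obtain ⟨r, hr, hrz⟩ : ∃ r : ℝ, 0 < r ∧ ((r * r : ℝ) : ℂ) = z := by
    obtain ⟨hre, him⟩ := Complex.pos_iff.1 hz0
    refine ⟨Real.sqrt z.re, Real.sqrt_pos.2 hre, ?_⟩
    rw [Real.mul_self_sqrt hre.le]
    exact Complex.ext rfl him
  have hrc : (r : ℂ) ≠ 0 := by exact_mod_cast hr.ne'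
  have hun : ∀ j ≤ L, ((r : ℂ)⁻¹ • T j)ᴴ * ((r : ℂ)⁻¹ • T j) = 1 := by
    intro j hj
    rw [Matrix.conjTranspose_smul, smul_mul_smul_comm, hgram' j hj, smul_smul, ← hrz]
    have : star (r : ℂ)⁻¹ * (r : ℂ)⁻¹ * ((r * r : ℝ) : ℂ) = 1 := by
      rw [star_inv₀, Complex.star_def, Complex.conj_ofReal]
      push_cast
      field_simp
    rw [this, one_smul]
  refine ⟨fun i => ⟨(r : ℂ)⁻¹ • T i, Matrix.mem_unitaryGroup_iff'.2 (hun i i.2.le)⟩, fun i => ?_⟩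
  have hsol : ∀ s, B i s = ((r : ℂ)⁻¹ • T i)ᴴ * A s * ((r : ℂ)⁻¹ • T (i + 1)) := fun s => by
    rw [Matrix.mul_smul, Matrix.mul_assoc, ← hint i i.2 s, ← Matrix.mul_smul, ← Matrix.smul_mul,
      ← Matrix.mul_assoc, hun i i.2.le, Matrix.one_mul]
  change ∃ θ : Circle, ∀ s, B i s = (θ : ℂ) • (((r : ℂ)⁻¹ • T i)ᴴ * A s
    * ((r : ℂ)⁻¹ • T ((i + 1 : Fin L) : ℕ)))
  by_cases hi : i.val + 1 < L
  · refine ⟨1, fun s => ?_⟩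
    rw [hsol s, Fin.val_add_one_of_lt' hi, Circle.coe_one, one_smul]
  -- The last site closes the ring: bond `0` carries `Y` instead of `T L = μ • Y`, and `μ` becomes
  -- the phase.
  · have hi' : i.val + 1 = L := by omega
    obtain ⟨θ, hθ⟩ : ∃ θ : Circle, (θ : ℂ) = μ := ⟨⟨μ, mem_sphere_zero_iff_norm.2 hμ1⟩, rfl⟩
    refine ⟨θ, fun s => ?_⟩
    have h0 : ((i + 1 : Fin L) : ℕ) = 0 := by
      rw [Fin.val_add]
      simp [hi']
    rw [hsol s, h0, hi', hL, smul_comm, Matrix.mul_smul, hθ]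
    rfl

end Bonds

end ModulatedMPS
end

noncomputable section
namespace ModulatedMPS
-- Cocycles on abelian groups and the commutator pairing.
section Cohomology

theorem circle_pow_surjective {n : ℤ} (hn : n ≠ 0) :
    Function.Surjective fun z : Circle => z ^ n := by
  intro z
  obtain ⟨t, rfl⟩ := Circle.exp_surjective z
  refine ⟨Circle.exp (t / n), ?_⟩
  have hn' : (n : ℝ) ≠ 0 := by exact_mod_cast hn
  change Circle.exp (t / n) ^ n = _
  rw [← Circle.exp_intCast_mul, mul_div_cancel₀ _ hn']

theorem baer_additive_circle : Module.Baer ℤ (Additive Circle) :=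
  letI : DivisibleBy (Additive Circle) ℤ :=
    divisibleByOfSMulRightSurj _ _ fun {_} hn => circle_pow_surjective hn
  Module.Baer.of_divisible _

/-- `U(1)` is an injective abelian group. -/
theorem exists_circle_extension {M N : Type*} [CommGroup M] [CommGroup N] (f : M →* N)
    (hf : Function.Injective f) (g : M →* Circle) : ∃ h : N →* Circle, h.comp f = g := by
  obtain ⟨h, hh⟩ := baer_additive_circle.extension_property_addMonoidHom
    (MonoidHom.toAdditive f) hf (MonoidHom.toAdditive g)
  exact ⟨MonoidHom.toAdditive.symm h, MonoidHom.ext fun x => DFunLike.congr_fun hh x⟩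

/-- The underlying type of the central extension of `G` by `U(1)` defined by a cocycle. -/
@[ext] structure CentralExtension {G : Type*} [CommGroup G] (ω : Z2 G) where
  phase : Circle
  elt : G

theorem cocycle_one_left {G : Type*} [Group G] {ω : G → G → Circle} (hω : ω ∈ Z2 G) (g : G) :
    ω 1 g = ω 1 1 := by
  have h := hω 1 1 g
  simp only [one_mul] at h
  rw [mul_comm] at h
  exact (mul_left_cancel h).symm

/-- The group structure of the abelian extension defined by a symmetric cocycle. -/
@[reducible] def CentralExtension.commGroup {G : Type*} [CommGroup G] (ω : Z2 G)
    (hs : ∀ g h, ω.1 g h = ω.1 h g) : CommGroup (CentralExtension ω) :=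
  letI : Mul (CentralExtension ω) :=
    ⟨fun x y => ⟨x.phase * y.phase * ω.1 x.elt y.elt, x.elt * y.elt⟩⟩
  -- Cocycles are not normalized, so the unit carries `ω(1,1)⁻¹`.
  letI : One (CentralExtension ω) := ⟨⟨(ω.1 1 1)⁻¹, 1⟩⟩
  letI : Inv (CentralExtension ω) :=
    ⟨fun x => ⟨x.phase⁻¹ * (ω.1 x.elt⁻¹ x.elt)⁻¹ * (ω.1 1 1)⁻¹, x.elt⁻¹⟩⟩
  { Group.ofLeftAxioms
      (fun x y z => by
        refine CentralExtension.ext ?_ (mul_assoc x.elt y.elt z.elt)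
        change x.phase * y.phase * ω.1 x.elt y.elt * z.phase * ω.1 (x.elt * y.elt) z.elt
          = x.phase * (y.phase * z.phase * ω.1 y.elt z.elt) * ω.1 x.elt (y.elt * z.elt)
        calc _ = x.phase * y.phase * z.phase
              * (ω.1 x.elt y.elt * ω.1 (x.elt * y.elt) z.elt) := by ac_rfl
          _ = x.phase * y.phase * z.phase
              * (ω.1 y.elt z.elt * ω.1 x.elt (y.elt * z.elt)) := by rw [ω.2]
          _ = _ := by ac_rfl)
      (fun x => by
        refine CentralExtension.ext ?_ (one_mul x.elt)
        change (ω.1 1 1)⁻¹ * x.phase * ω.1 1 x.elt = x.phase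
        rw [cocycle_one_left ω.2 x.elt, mul_right_comm, inv_mul_cancel, one_mul])
      (fun x => by
        refine CentralExtension.ext ?_ (inv_mul_cancel x.elt)
        change x.phase⁻¹ * (ω.1 x.elt⁻¹ x.elt)⁻¹ * (ω.1 1 1)⁻¹ * x.phase * ω.1 x.elt⁻¹ x.elt
          = (ω.1 1 1)⁻¹
        calc _ = (x.phase⁻¹ * x.phase) * ((ω.1 x.elt⁻¹ x.elt)⁻¹ * ω.1 x.elt⁻¹ x.elt)
              * (ω.1 1 1)⁻¹ := by ac_rfl
          _ = _ := by simp) with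
    mul_comm := fun x y => by
      refine CentralExtension.ext ?_ (mul_comm x.elt y.elt)
      change x.phase * y.phase * ω.1 x.elt y.elt = y.phase * x.phase * ω.1 y.elt x.elt
      rw [hs, mul_comm x.phase] }

/-- A symmetric `U(1)`-valued 2-cocycle on an abelian group is a coboundary. -/
theorem mem_B2_of_symm {G : Type*} [CommGroup G] (ω : Z2 G) (hs : ∀ g h, ω.1 g h = ω.1 h g) :
    ω.1 ∈ B2 G := by
  let := CentralExtension.commGroup ω hs
  have hmul : ∀ x y : CentralExtension ω,
      x * y = ⟨x.phase * y.phase * ω.1 x.elt y.elt, x.elt * y.elt⟩ := fun _ _ => rfl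
  let ι : Circle →* CentralExtension ω := MonoidHom.mk' (fun a => ⟨a * (ω.1 1 1)⁻¹, 1⟩) (by
    intro a b
    rw [hmul]
    refine CentralExtension.ext ?_ (mul_one 1).symm
    change a * b * (ω.1 1 1)⁻¹ = a * (ω.1 1 1)⁻¹ * (b * (ω.1 1 1)⁻¹) * ω.1 1 1
    rw [← mul_assoc, inv_mul_cancel_right, mul_right_comm])
  have hι : Function.Injective ι := fun a b h => mul_right_cancel (congrArg (fun x => x.phase) h)
  -- Injectivity of `U(1)` gives a retraction onto the central circle. Its values on the section `g
  -- ↦ (1, g)` form the cochain with coboundary `ω`.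
  obtain ⟨r, hr⟩ := exists_circle_extension ι hι (MonoidHom.id Circle)
  refine ⟨fun g => r ⟨1, g⟩, fun g h => ?_⟩
  have hrι : r (ι (ω.1 g h)) = ω.1 g h := DFunLike.congr_fun hr _
  have hprod : (⟨1, g⟩ * ⟨1, h⟩ : CentralExtension ω) = ι (ω.1 g h) * ⟨1, g * h⟩ := by
    rw [hmul, hmul]
    refine CentralExtension.ext ?_ (one_mul (g * h)).symm
    change 1 * 1 * ω.1 g h = ω.1 g h * (ω.1 1 1)⁻¹ * 1 * ω.1 1 (g * h)
    rw [cocycle_one_left ω.2 (g * h)]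
    simp
  rw [← map_mul, hprod, map_mul, hrι, mul_div_cancel_right]

/-- This combines the cocycle identities for `(g,h,k)`, `(k,g,h)` and `(g,k,h)`, whose arguments
match because `G` is abelian. It makes the pairing bimultiplicative. -/
theorem commutator_mul_left {G : Type*} [CommGroup G] {ω : G → G → Circle} (hω : ω ∈ Z2 G)
    (g h k : G) : ω (g * h) k / ω k (g * h) = (ω g k / ω k g) * (ω h k / ω k h) := by
  rw [div_mul_div_comm, div_eq_div_iff_mul_eq_mul]
  refine mul_left_cancel (a := ω g h * ω (g * k) h) ?_
  have h1 := hω g h k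
  have h2 := hω k g h
  have h3 := hω g k h
  rw [mul_comm k g] at h2
  rw [mul_comm k h] at h3
  calc _ = (ω g h * ω (g * h) k) * (ω k g * ω (g * k) h) * ω k h := by ac_rfl
    _ = (ω k h * ω g (h * k)) * (ω g h * ω h k * ω k (g * h)) := by rw [h1, h2]; ac_rfl
    _ = (ω g k * ω (g * k) h) * (ω g h * ω h k * ω k (g * h)) := by rw [h3]
    _ = _ := by ac_rfl

/-- The commutator pairing `ω(g,h) ω(h,g)⁻¹` of a 2-cocycle on an abelian group. -/
def commutatorPairing {G : Type*} [CommGroup G] (ω : Z2 G) : G →* G →* Circle :=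
  MonoidHom.mk'
    (fun g => MonoidHom.mk' (fun h => ω.1 g h / ω.1 h g) fun h k => by
      rw [← inv_div, commutator_mul_left ω.2, mul_inv, inv_div, inv_div])
    fun g h => MonoidHom.ext fun k => commutator_mul_left ω.2 g h k

theorem commutatorPairing_apply {G : Type*} [CommGroup G] (ω : Z2 G) (g h : G) :
    commutatorPairing ω g h = ω.1 g h / ω.1 h g := rfl

theorem div_swap_eq_one_of_mem_B2 {G : Type*} [CommGroup G] {ω : G → G → Circle}
    (h : ω ∈ B2 G) (g k : G) : ω g k / ω k g = 1 := by
  obtain ⟨β, hβ⟩ := h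
  rw [hβ, hβ, mul_comm (β k), mul_comm k, div_self']

/-- A cocycle on an abelian group is a coboundary iff its commutator pairing is trivial. -/
theorem mem_B2_iff {G : Type*} [CommGroup G] {ω : G → G → Circle} (hω : ω ∈ Z2 G) :
    ω ∈ B2 G ↔ ∀ g h, ω g h / ω h g = 1 :=
  ⟨div_swap_eq_one_of_mem_B2, fun h => mem_B2_of_symm ⟨ω, hω⟩ fun g k => div_eq_one.1 (h g k)⟩

theorem H2.mk_eq_mk_iff {G : Type*} [Group G] {ω ω' : Z2 G} :
    H2.mk ω = H2.mk ω' ↔ ω'.1 / ω.1 ∈ B2 G := by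
  rw [H2.mk, H2.mk, QuotientGroup.eq, Subgroup.mem_subgroupOf, div_eq_inv_mul]
  rfl

/-- Two pairings agree exactly when the quotient cocycle is symmetric, that is, a coboundary. -/
theorem H2.mk_eq_mk_iff_commutatorPairing {G : Type*} [CommGroup G] {ω ω' : Z2 G} :
    H2.mk ω = H2.mk ω' ↔ commutatorPairing ω = commutatorPairing ω' := by
  rw [H2.mk_eq_mk_iff, mem_B2_iff ((Z2 G).div_mem ω'.2 ω.2), DFunLike.ext_iff]
  refine forall_congr' fun g => ?_
  rw [DFunLike.ext_iff]
  refine forall_congr' fun h => ?_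
  simp only [Pi.div_apply, commutatorPairing_apply]
  rw [div_div_div_comm, div_eq_one, eq_comm]

/-! ### Sectors of a class on a product group. -/

section Sectors

variable {Ga Gb : Type*} [CommGroup Ga] [CommGroup Gb]

theorem sectorA_mem_Z2 (ω : Z2 (Ga × Gb)) : sectorA ω.1 ∈ Z2 Ga := by
  intro g h k
  simpa [sectorA] using ω.2 (g, 1) (h, 1) (k, 1)

theorem sectorB_mem_Z2 (ω : Z2 (Ga × Gb)) : sectorB ω.1 ∈ Z2 Gb := by
  intro g h k
  simpa [sectorB] using ω.2 (1, g) (1, h) (1, k)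

theorem sectorMixed_mem_Z2 (ω : Z2 (Ga × Gb)) : sectorMixed ω.1 ∈ Z2 (Ga × Gb) := by
  have hA : (fun g h : Ga × Gb => sectorA ω.1 g.1 h.1) ∈ Z2 (Ga × Gb) :=
    fun g h k => sectorA_mem_Z2 ω g.1 h.1 k.1
  have hB : (fun g h : Ga × Gb => sectorB ω.1 g.2 h.2) ∈ Z2 (Ga × Gb) :=
    fun g h k => sectorB_mem_Z2 ω g.2 h.2 k.2
  exact (Z2 (Ga × Gb)).div_mem ω.2 ((Z2 (Ga × Gb)).mul_mem hA hB)

/-- The commutator pairing in terms of its sectors. -/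
theorem commutatorPairing_prod (ω : Z2 (Ga × Gb)) (g h : Ga × Gb) :
    commutatorPairing ω g h
      = commutatorPairing ω (g.1, 1) (h.1, 1) * commutatorPairing ω (1, g.2) (1, h.2)
        * (mixedPhase ω.1 g.1 h.2 / mixedPhase ω.1 h.1 g.2) := by
  have hsplit : ∀ x : Ga × Gb, x = (x.1, 1) * (1, x.2) := fun x => by simp
  have hinv : commutatorPairing ω (1, g.2) (h.1, 1) = (mixedPhase ω.1 h.1 g.2)⁻¹ := by
    rw [commutatorPairing_apply, mixedPhase, inv_div]
  have hm : commutatorPairing ω (g.1, 1) (1, h.2) = mixedPhase ω.1 g.1 h.2 := rfl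
  conv_lhs => rw [hsplit g, hsplit h, map_mul (commutatorPairing ω), MonoidHom.mul_apply]
  rw [map_mul (commutatorPairing ω (g.1, 1)),
    map_mul (commutatorPairing ω (1, g.2)), hinv, hm, div_eq_mul_inv]
  ac_rfl

/-- A class on `Ga × Gb` that is invariant under `(g_a, g_b) ↦ (g_a ^ a, g_b ^ b)` has sectors of
finite order. -/
theorem sector_constraints (a b : ℤ) (ω : Z2 (Ga × Gb))
    (hinv : ∀ g h : Ga × Gb, commutatorPairing ω (g.1 ^ a, g.2 ^ b) (h.1 ^ a, h.2 ^ b)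
      = commutatorPairing ω g h) :
    sectorA ω.1 ^ (a ^ 2 - 1) ∈ B2 Ga ∧ sectorMixed ω.1 ^ (a * b - 1) ∈ B2 (Ga × Gb) ∧
      (∀ ga gb, mixedPhase ω.1 ga gb ^ (a * b - 1) = 1) ∧ sectorB ω.1 ^ (b ^ 2 - 1) ∈ B2 Gb := by
  -- Bimultiplicativity turns the substitution into exponents `a * a`, `a * b`, `b * b` on the three
  -- sectors; invariance then gives `x ^ n = x`.
  have hpow : ∀ (g h : Ga × Gb) (m n : ℤ), commutatorPairing ω (g ^ m) (h ^ n)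
      = commutatorPairing ω g h ^ (m * n) := fun g h m n => by
    rw [map_zpow, map_zpow, MonoidHom.zpow_apply, ← zpow_mul]
  have hfix : ∀ (x : Circle) (n : ℤ), x ^ n = x → x ^ (n - 1) = 1 := fun x n h => by
    rw [zpow_sub_one, h, mul_inv_cancel]
  have hmixed : ∀ ga gb, mixedPhase ω.1 ga gb ^ (a * b - 1) = 1 := fun ga gb => by
    have h := hinv (ga, 1) (1, gb)
    have h' := hpow (ga, 1) (1, gb) a b
    simp only [Prod.pow_mk, one_zpow] at h h'
    exact hfix _ _ (h'.symm.trans h)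
  refine ⟨?_, ?_, hmixed, ?_⟩
  · rw [mem_B2_iff ((Z2 Ga).zpow_mem (sectorA_mem_Z2 ω) _)]
    intro g k
    have h := hinv (g, 1) (k, 1)
    have h' := hpow (g, 1) (k, 1) a a
    simp only [Prod.pow_mk, one_zpow] at h h'
    rw [Pi.pow_apply, Pi.pow_apply, Pi.pow_apply, Pi.pow_apply, ← div_zpow]
    refine hfix _ _ ?_
    rw [pow_two]
    exact h'.symm.trans h
  · rw [mem_B2_iff ((Z2 _).zpow_mem (sectorMixed_mem_Z2 ω) _)]
    intro g k
    rw [Pi.pow_apply, Pi.pow_apply, Pi.pow_apply, Pi.pow_apply, ← div_zpow]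
    have h := commutatorPairing_prod ω g k
    -- The pure sectors cancel, leaving a quotient of mixed phases.
    have h2 : sectorMixed ω.1 g k / sectorMixed ω.1 k g
        = mixedPhase ω.1 g.1 k.2 / mixedPhase ω.1 k.1 g.2 := by
      have h3 : sectorMixed ω.1 g k / sectorMixed ω.1 k g = commutatorPairing ω g k
          / (commutatorPairing ω (g.1, 1) (k.1, 1) * commutatorPairing ω (1, g.2) (1, k.2)) := by
        simp only [commutatorPairing_apply]
        rw [div_mul_div_comm, div_div_div_comm]
        rfl
      rw [h3, h, mul_div_cancel_left]
    rw [h2, div_zpow, hmixed, hmixed, div_one]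
  · rw [mem_B2_iff ((Z2 Gb).zpow_mem (sectorB_mem_Z2 ω) _)]
    intro g k
    have h := hinv (1, g) (1, k)
    have h' := hpow (1, g) (1, k) b b
    simp only [Prod.pow_mk, one_zpow] at h h'
    rw [Pi.pow_apply, Pi.pow_apply, Pi.pow_apply, Pi.pow_apply, ← div_zpow]
    refine hfix _ _ ?_
    rw [pow_two]
    exact h'.symm.trans h

end Sectors

end Cohomology

end ModulatedMPS
end

noncomputable section
namespace ModulatedMPS
open Matrix

/-! ### Uniqueness of bond unitaries and their cohomology class. -/

section BondUnitaries

variable {d χ : ℕ} {A : Fin d → Matrix (Fin χ) (Fin χ) ℂ}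

theorem smul_unitary_injective [Nonempty (Fin χ)] (v : unitaryGroup (Fin χ) ℂ) {x y : Circle}
    (h : (x : ℂ) • v.1 = (y : ℂ) • v.1) : x = y := by
  have hv : v.1 ≠ 0 := fun h0 => by
    have h1 := Unitary.coe_mul_star_self v
    rw [h0, zero_mul] at h1
    exact zero_ne_one h1
  exact Circle.ext (smul_left_injective ℂ hv h)

/-- The bond unitaries of a symmetry are unique up to phases. -/
theorem IsInjectiveMPS.gauge_unique (hA : IsInjectiveMPS A) {L : ℕ} [NeZero L]
    {B : Fin L → Fin d → Matrix (Fin χ) (Fin χ) ℂ} {v w : Fin L → unitaryGroup (Fin χ) ℂ}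
    (hv : ∀ i, ∃ θ : Circle, ∀ s, B i s = (θ : ℂ) • ((v i).1ᴴ * A s * (v (i + 1)).1))
    (hw : ∀ i, ∃ θ : Circle, ∀ s, B i s = (θ : ℂ) • ((w i).1ᴴ * A s * (w (i + 1)).1))
    (i : Fin L) : ∃ φ : Circle, (w i).1 = (φ : ℂ) • (v i).1 := by
  set u : Fin L → unitaryGroup (Fin χ) ℂ := fun i => w i * star (v i) with hu
  -- Equating the two gauges gives `u i * A s ≐ A s * u (i + 1)`, and left canonicity removes the
  -- tensor.
  have hstep : ∀ i, ∃ θ : Circle, dualTransfer A A (u i).1 = (θ : ℂ) • (u (i + 1)).1 := by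
    intro i
    obtain ⟨θ, hθ⟩ := hv i
    obtain ⟨η, hη⟩ := hw i
    refine ⟨η / θ, ?_⟩
    have h1 : ∀ s, (u i).1 * A s = ((η / θ : Circle) : ℂ) • (A s * (u (i + 1)).1) := by
      intro s
      have h2 := congrArg (fun X => (w i).1 * X * (star (v (i + 1))).1) ((hθ s).symm.trans (hη s))
      have h3 : (v (i + 1)).1 * (star (v (i + 1))).1 = 1 := Unitary.coe_mul_star_self _
      have h4 : (w i).1 * (w i).1ᴴ = 1 := Unitary.coe_mul_star_self _
      simp only [Matrix.mul_smul, Matrix.smul_mul] at h2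
      have h5 : (w i).1 * ((v i).1ᴴ * A s * (v (i + 1)).1) * (star (v (i + 1))).1
          = (u i).1 * A s := by
        simp only [Matrix.mul_assoc, h3, Matrix.mul_one]
        rw [← Matrix.mul_assoc]
        rfl
      have h6 : (w i).1 * ((w i).1ᴴ * A s * (w (i + 1)).1) * (star (v (i + 1))).1
          = A s * (u (i + 1)).1 := by
        simp only [← Matrix.mul_assoc, h4, Matrix.one_mul]
        rw [Matrix.mul_assoc]
        rfl
      rw [h5, h6] at h2
      rw [Circle.coe_div, div_eq_inv_mul, mul_smul, ← h2, inv_smul_smul₀ (Circle.coe_ne_zero θ)]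
    simp only [dualTransfer, Matrix.mul_assoc, h1, Matrix.mul_smul]
    rw [← Finset.smul_sum]
    simp only [← Matrix.mul_assoc]
    rw [← Finset.sum_mul, hA.left_canonical, Matrix.one_mul]
  have hiter : ∀ (k : ℕ), ∃ θ : Circle,
      (dualTransfer A A)^[k] (u i).1 = (θ : ℂ) • (u (i + k • (1 : Fin L))).1 := by
    intro k
    induction k with
    | zero => exact ⟨1, by simp⟩
    | succ k ih =>
      obtain ⟨θ, hθ⟩ := ih
      obtain ⟨η, hη⟩ := hstep (i + k • (1 : Fin L))
      refine ⟨θ * η, ?_⟩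
      rw [Function.iterate_succ_apply', hθ, dualTransfer_smul, hη, smul_smul, Circle.coe_mul,
        succ_nsmul, add_assoc]
  -- After `L` steps the bond is the original one, so `u i` is an eigenvector with unimodular
  -- eigenvalue, hence scalar.
  obtain ⟨θ, hθ⟩ := hiter L
  have hLone : L • (1 : Fin L) = 0 := by
    simpa only [Fintype.card_fin] using card_nsmul_eq_zero (x := (1 : Fin L))
  rw [hLone, add_zero] at hθ
  obtain ⟨z, hz⟩ := hA.eq_smul_one (NeZero.pos L) (Circle.norm_coe θ) hθ
  have hz1 : ‖z‖ = 1 := by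
    have h1 : star (u i).1 * (u i).1 = 1 := Unitary.coe_star_mul_self _
    obtain ⟨j⟩ := hA.nonempty
    rw [hz, star_smul, star_one, smul_mul_smul_comm, one_mul] at h1
    have h2 := congrFun (congrFun h1 j) j
    simp only [Matrix.smul_apply, Matrix.one_apply_eq, smul_eq_mul, mul_one] at h2
    rw [Complex.star_def, ← Complex.normSq_eq_conj_mul_self, Complex.normSq_eq_norm_sq] at h2
    have h3 : ‖z‖ ^ 2 = 1 := by exact_mod_cast h2
    exact (pow_eq_one_iff_of_nonneg (norm_nonneg z) two_ne_zero).1 h3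
  refine ⟨⟨z, mem_sphere_zero_iff_norm.2 hz1⟩, ?_⟩
  have h1 : (w i).1 = (u i).1 * (v i).1 := by
    have h2 : (star (v i)).1 * (v i).1 = 1 := Unitary.coe_star_mul_self _
    change _ = (w i).1 * (star (v i)).1 * (v i).1
    rw [Matrix.mul_assoc, h2, Matrix.mul_one]
  rw [h1, hz, Matrix.smul_mul, Matrix.one_mul]

section FactorSystems

variable {G : Type*} [Group G]

theorem IsFactorSystem.mem_Z2 [Nonempty (Fin χ)] {v : G → unitaryGroup (Fin χ) ℂ}
    {ω : G → G → Circle} (h : IsFactorSystem v ω) : ω ∈ Z2 G := by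
  intro g k l
  refine smul_unitary_injective (v (g * k * l)) ?_
  have h1 : (v g).1 * (v k).1 * (v l).1
      = ((ω g k * ω (g * k) l : Circle) : ℂ) • (v (g * k * l)).1 := by
    rw [h g k, Matrix.smul_mul, h (g * k) l, smul_smul, Circle.coe_mul]
  have h2 : (v g).1 * ((v k).1 * (v l).1)
      = ((ω k l * ω g (k * l) : Circle) : ℂ) • (v (g * (k * l))).1 := by
    rw [h k l, Matrix.mul_smul, h g (k * l), smul_smul, Circle.coe_mul]
  rw [← h1, mul_assoc g k l, ← h2, Matrix.mul_assoc]

/-- Rephasing a projective representation does not change the class of its factor system. -/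
theorem IsFactorSystem.mk_eq_of_smul [Nonempty (Fin χ)] {v w : G → unitaryGroup (Fin χ) ℂ}
    {ω η : Z2 G} (hω : IsFactorSystem v ω.1) (hη : IsFactorSystem w η.1)
    (h : ∀ g, ∃ φ : Circle, (w g).1 = (φ : ℂ) • (v g).1) : H2.mk ω = H2.mk η := by
  choose β hβ using h
  rw [H2.mk_eq_mk_iff]
  refine ⟨β, fun g k => ?_⟩
  rw [Pi.div_apply, Pi.div_apply, div_eq_div_iff_mul_eq_mul]
  refine smul_unitary_injective (v (g * k)) ?_
  have h1 := hη g k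
  rw [hβ, hβ, hβ, smul_mul_smul_comm, hω g k, smul_smul, smul_smul] at h1
  simpa only [Circle.coe_mul] using h1.symm

variable {L : ℕ} [NeZero L] {W : Fin L → G → unitaryGroup (Fin d) ℂ}
  {v w : Fin L → G → unitaryGroup (Fin χ) ℂ}

/-- The site action is linear and passes through the bond factors, so bond matrices multiply in the
same order as site matrices. -/
theorem siteAct_mul_eq {W₁ W₂ : Matrix (Fin d) (Fin d) ℂ} {θ₁ θ₂ : Circle}
    {v₁ v₂ w₁ w₂ : Matrix (Fin χ) (Fin χ) ℂ}
    (h₁ : ∀ s, siteAct W₁ A s = (θ₁ : ℂ) • (v₁ᴴ * A s * w₁))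
    (h₂ : ∀ s, siteAct W₂ A s = (θ₂ : ℂ) • (v₂ᴴ * A s * w₂)) (s : Fin d) :
    siteAct (W₁ * W₂) A s
      = ((θ₁ * θ₂ : Circle) : ℂ) • ((v₁ * v₂)ᴴ * A s * (w₁ * w₂)) := by
  rw [← siteAct_siteAct, funext h₂, siteAct_smul, siteAct_mul_mul, h₁, Matrix.mul_smul,
    Matrix.smul_mul, smul_smul, mul_comm (θ₂ : ℂ), Circle.coe_mul, Matrix.conjTranspose_mul]
  simp only [Matrix.mul_assoc]

/-- Bond unitaries of a symmetry form projective representations. -/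
theorem IsBondUnitaries.exists_factorSystem (hA : IsInjectiveMPS A)
    (hW : ∀ i g h, W i (g * h) = W i g * W i h) (hv : IsBondUnitaries A W v) (i : Fin L) :
    ∃ ω : Z2 G, IsFactorSystem (v i) ω.1 := by
  have := hA.nonempty
  have h : ∀ g h, ∃ φ : Circle,
      (v i g).1 * (v i h).1 = (φ : ℂ) • (v i (g * h)).1 := by
    intro g h
    refine hA.gauge_unique (B := fun i => siteAct (W i (g * h)).1 A)
      (v := fun i => v i (g * h)) (w := fun i => v i g * v i h) (fun i => hv i (g * h))
      (fun i => ?_) i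
    obtain ⟨θ, hθ⟩ := hv i g
    obtain ⟨η, hη⟩ := hv i h
    refine ⟨θ * η, fun s => ?_⟩
    rw [hW]
    exact siteAct_mul_eq hθ hη s
  choose ω hω using h
  exact ⟨⟨ω, IsFactorSystem.mem_Z2 hω⟩, hω⟩

/-- The projective representations on neighbouring bonds carry the same class. -/
theorem IsBondUnitaries.mk_eq_succ (hA : IsInjectiveMPS A)
    (hW : ∀ i g h, W i (g * h) = W i g * W i h) (hv : IsBondUnitaries A W v) {i : Fin L}
    {ω η : Z2 G} (hω : IsFactorSystem (v i) ω.1) (hη : IsFactorSystem (v (i + 1)) η.1) :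
    H2.mk ω = H2.mk η := by
  choose θ hθ using hv i
  rw [H2.mk_eq_mk_iff]
  -- The site phases trivialize the quotient: comparing the actions of `g h` and of `g` after `h`
  -- gives `θ(gh) = θ(g) θ(h) η(g,h) ω(g,h)⁻¹`. A nonzero `A s` allows the scalars to be compared.
  refine ⟨fun g => (θ g)⁻¹, fun g h => ?_⟩
  obtain ⟨s, hs⟩ := hA.exists_ne_zero
  have h1 := siteAct_mul_eq (hθ g) (hθ h) s
  have h2 : siteAct ((W i g).1 * (W i h).1) A s
      = (θ (g * h) : ℂ) • ((v i (g * h)).1ᴴ * A s * (v (i + 1) (g * h)).1) := by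
    have h3 := hθ (g * h) s
    rw [hW] at h3
    exact h3
  rw [h2, hω g h, hη g h, Matrix.conjTranspose_smul, Matrix.smul_mul, Matrix.mul_smul,
    Matrix.smul_mul, smul_smul, smul_smul] at h1
  have hne : (v i (g * h)).1ᴴ * A s * (v (i + 1) (g * h)).1 ≠ 0 := by
    intro h0
    apply hs
    have h4 : (v i (g * h)).1 * (v i (g * h)).1ᴴ = 1 := Unitary.coe_mul_star_self _
    have h5 : (v (i + 1) (g * h)).1 * (v (i + 1) (g * h)).1ᴴ = 1 := Unitary.coe_mul_star_self _
    calc A s = (v i (g * h)).1 * (v i (g * h)).1ᴴ * A s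
          * ((v (i + 1) (g * h)).1 * (v (i + 1) (g * h)).1ᴴ) := by
          rw [h4, h5, Matrix.one_mul, Matrix.mul_one]
      _ = (v i (g * h)).1 * ((v i (g * h)).1ᴴ * A s * (v (i + 1) (g * h)).1)
          * (v (i + 1) (g * h)).1ᴴ := by simp only [Matrix.mul_assoc]
      _ = 0 := by rw [h0, Matrix.mul_zero, Matrix.zero_mul]
  have h6 := smul_left_injective ℂ hne h1
  have h7 : θ (g * h) = θ g * θ h * (η.1 g h * (ω.1 g h)⁻¹) := by
    refine Circle.ext ?_
    rw [h6, Complex.star_def, ← Circle.coe_inv_eq_conj]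
    simp only [Circle.coe_mul]
    ring
  change η.1 g h / ω.1 g h = (θ g)⁻¹ * (θ h)⁻¹ / (θ (g * h))⁻¹
  rw [h7]
  rw [div_inv_eq_mul, ← mul_inv, inv_mul_cancel_left, div_eq_mul_inv]

/-- All bonds and all choices of bond unitaries of a symmetry carry the same class. -/
theorem IsBondUnitaries.mk_eq_mk (hA : IsInjectiveMPS A)
    (hW : ∀ i g h, W i (g * h) = W i g * W i h) (hv : IsBondUnitaries A W v)
    (hw : IsBondUnitaries A W w) {i j : Fin L} {ω η : Z2 G} (hω : IsFactorSystem (v i) ω.1)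
    (hη : IsFactorSystem (w j) η.1) : H2.mk ω = H2.mk η := by
  have := hA.nonempty
  choose σ hσ using hv.exists_factorSystem hA hW
  have hself : ∀ {v w : Fin L → G → unitaryGroup (Fin χ) ℂ} (_ : IsBondUnitaries A W v)
      (_ : IsBondUnitaries A W w) {i : Fin L} {ω η : Z2 G} (_ : IsFactorSystem (v i) ω.1)
      (_ : IsFactorSystem (w i) η.1), H2.mk ω = H2.mk η := by
    intro v w hv hw i ω η hω hη
    refine hω.mk_eq_of_smul hη fun g => ?_
    exact hA.gauge_unique (B := fun i => siteAct (W i g).1 A) (v := fun i => v i g)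
      (w := fun i => w i g) (fun i => hv i g) (fun i => hw i g) i
  have hzero : ∀ (n : ℕ) (hn : n < L), H2.mk (σ ⟨n, hn⟩) = H2.mk (σ 0) := by
    intro n
    induction n with
    | zero => intro _; rfl
    | succ n ih =>
      intro hn
      have hs : (⟨n + 1, hn⟩ : Fin L) = ⟨n, by omega⟩ + 1 :=
        Fin.ext (Fin.val_add_one_of_lt' (i := ⟨n, by omega⟩) hn).symm
      rw [← ih (by omega), hs]
      exact (hv.mk_eq_succ hA hW (hσ _) (hσ _)).symm
  have hall : ∀ i, H2.mk (σ i) = H2.mk (σ 0) := fun i => hzero i.val i.2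
  rw [hself hv hv hω (hσ i), hall i, ← hall j, hself hv hw (hσ j) hη]

end FactorSystems

/-! ### Translation of exponential symmetries. -/

section Exponential

variable {Ga Gb : Type*} [CommGroup Ga] [CommGroup Gb]

theorem siteUnitary_eq (U : Ga × Gb →* unitaryGroup (Fin d) ℂ) (a b : ℤ) (j : ℕ) (g : Ga × Gb) :
    siteUnitary U a b j g = U (g.1 ^ a ^ j, g.2 ^ b ^ j) := by
  rw [siteUnitary, ← map_zpow, ← map_zpow, ← map_mul]
  simp [-Matrix.one_zpow]

theorem siteUnitary_mul (U : Ga × Gb →* unitaryGroup (Fin d) ℂ) (a b : ℤ) (j : ℕ)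
    (g h : Ga × Gb) :
    siteUnitary U a b j (g * h) = siteUnitary U a b j g * siteUnitary U a b j h := by
  simp only [siteUnitary_eq, ← map_mul, Prod.mk_mul_mk, Prod.fst_mul, Prod.snd_mul, _root_.mul_zpow]

/-- A shift by one site is absorbed by the power map `(g_a, g_b) ↦ (g_a ^ a, g_b ^ b)`; this is the
source of the cocycle constraints. -/
theorem siteUnitary_succ (U : Ga × Gb →* unitaryGroup (Fin d) ℂ) (a b : ℤ) (j : ℕ)
    (g : Ga × Gb) :
    siteUnitary U a b (j + 1) g = siteUnitary U a b j (g.1 ^ a, g.2 ^ b) := by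
  simp only [siteUnitary_eq, ← _root_.zpow_mul, pow_succ']

/-- A symmetric injective MPS has bond unitaries. -/
theorem IsSymmetricMPS.exists_isBondUnitaries (hA : IsInjectiveMPS A)
    {U : Ga × Gb →* unitaryGroup (Fin d) ℂ} {a b : ℤ} {L : ℕ} [NeZero L]
    (hS : IsSymmetricMPS A U a b L) :
    ∃ v : Fin L → Ga × Gb → unitaryGroup (Fin χ) ℂ,
      IsBondUnitaries A (fun i g => siteUnitary U a b i.val g) v := by
  have h : ∀ g, ∃ v : Fin L → unitaryGroup (Fin χ) ℂ, ∀ i : Fin L, ∃ θ : Circle, ∀ s,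
      siteAct (siteUnitary U a b i.val g).1 A s
        = (θ : ℂ) • ((v i).1ᴴ * A s * (v (i + 1)).1) := by
    intro g
    refine exists_unitary_gauge hA (fun j => siteAct (siteUnitary U a b j g).1 A)
      (fun j => mixedTransfer_siteAct_self _ A) fun k hk => ?_
    obtain ⟨θ, hθ⟩ := hS g k hk
    refine ⟨θ, fun s => ?_⟩
    rw [← hθ s]
    exact (sum_prod_mul_mpsState
      (fun i : Fin (k * L) => (siteUnitary U a b (i.val % L) g).1) A s).symm
  choose v hv using h
  exact ⟨fun i g => v g i, fun i g => hv g i⟩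

/-- Translating bond unitaries by one site. -/
theorem IsBondUnitaries.translate {U : Ga × Gb →* unitaryGroup (Fin d) ℂ} {a b : ℤ} {L : ℕ}
    [NeZero L] (ha : ∀ g : Ga, g ^ (a ^ L) = g) (hb : ∀ g : Gb, g ^ (b ^ L) = g)
    {v : Fin L → Ga × Gb → unitaryGroup (Fin χ) ℂ}
    (hv : IsBondUnitaries A (fun i g => siteUnitary U a b i.val g) v) :
    IsBondUnitaries A (fun i g => siteUnitary U a b i.val g)
      fun i g => v (i - 1) (g.1 ^ a, g.2 ^ b) := by
  intro i g
  have h := hv (i - 1) (g.1 ^ a, g.2 ^ b)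
  have hW : siteUnitary U a b (i - 1).val (g.1 ^ a, g.2 ^ b) = siteUnitary U a b i.val g := by
    rw [← siteUnitary_succ]
    obtain ⟨j, rfl⟩ : ∃ j, i = j + 1 := ⟨i - 1, (sub_add_cancel i 1).symm⟩
    rw [add_sub_cancel_right]
    by_cases hj : j.val + 1 < L
    · rw [Fin.val_add_one_of_lt' hj]
    -- At the seam, the exponents `a ^ L` and `b ^ L` act trivially by periodicity.
    · have hj' : j.val + 1 = L := by omega
      have h0 : ((j + 1 : Fin L) : ℕ) = 0 := by
        rw [Fin.val_add]
        simp [hj']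
      rw [h0, hj', siteUnitary_eq, siteUnitary_eq, ha, hb]
      simp
  simp only [hW, sub_add_cancel] at h
  simpa only [add_sub_cancel_right] using h

/-- The class carried by the bond unitaries of a symmetric injective MPS is invariant under
translations. -/
theorem IsBondUnitaries.commutatorPairing_invariant (hA : IsInjectiveMPS A)
    {U : Ga × Gb →* unitaryGroup (Fin d) ℂ} {a b : ℤ} {L : ℕ}
    [NeZero L] (ha : ∀ g : Ga, g ^ (a ^ L) = g) (hb : ∀ g : Gb, g ^ (b ^ L) = g)
    {v : Fin L → Ga × Gb → unitaryGroup (Fin χ) ℂ}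
    (hv : IsBondUnitaries A (fun i g => siteUnitary U a b i.val g) v) {i : Fin L}
    {ω : Z2 (Ga × Gb)} (hω : IsFactorSystem (v i) ω.1) (g h : Ga × Gb) :
    commutatorPairing ω (g.1 ^ a, g.2 ^ b) (h.1 ^ a, h.2 ^ b) = commutatorPairing ω g h := by
  have := hA.nonempty
  have hη : IsFactorSystem (fun g : Ga × Gb => v (i + 1 - 1) (g.1 ^ a, g.2 ^ b))
      (fun g h => ω.1 (g.1 ^ a, g.2 ^ b) (h.1 ^ a, h.2 ^ b)) := by
    intro g h
    have h1 := hω (g.1 ^ a, g.2 ^ b) (h.1 ^ a, h.2 ^ b)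
    simpa only [add_sub_cancel_right, Prod.fst_mul, Prod.snd_mul, _root_.mul_zpow,
      Prod.mk_mul_mk] using h1
  -- The translated bond unitaries carry the cocycle pulled back along the power map, and every
  -- choice carries the same class.
  have h1 := hv.mk_eq_mk hA (fun i => siteUnitary_mul U a b i.val) (hv.translate ha hb)
    (j := i + 1) (η := ⟨_, hη.mem_Z2⟩) hω hη
  rw [H2.mk_eq_mk_iff_commutatorPairing] at h1
  exact (DFunLike.congr_fun (DFunLike.congr_fun h1 g) h).symm

end Exponential

end BondUnitaries

end ModulatedMPS
end

noncomputable section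
namespace ModulatedMPS
open Matrix
open scoped Kronecker ComplexOrder

/-! ### The fixed-point tensor of maximally entangled pairs. -/

section FixedPointTensor

/-- The tensor of matrix units, whose states are products of maximally entangled pairs. -/
def matrixUnitTensor (n : ℕ) (s : Fin (n * n)) : Matrix (Fin n) (Fin n) ℂ :=
  ((Real.sqrt n : ℝ) : ℂ)⁻¹
    • Matrix.single (finProdFinEquiv.symm s).1 (finProdFinEquiv.symm s).2 1

theorem sqrt_inv_mul_self (n : ℕ) :
    ((Real.sqrt n : ℝ) : ℂ)⁻¹ * ((Real.sqrt n : ℝ) : ℂ)⁻¹ = (n : ℂ)⁻¹ := by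
  rw [← mul_inv, ← Complex.ofReal_mul, Real.mul_self_sqrt (Nat.cast_nonneg n),
    Complex.ofReal_natCast]

/-- Having rank one, the transfer matrix has a single nonzero eigenvalue, which gives simplicity and
the gap. -/
theorem transferMatrix_matrixUnitTensor (n : ℕ) :
    transferMatrix (matrixUnitTensor n) = (n : ℂ)⁻¹ • vecMulVec (vec 1) (vec 1) := by
  ext ⟨i, k⟩ ⟨j, l⟩
  rw [transferMatrix, Matrix.sum_apply, ← finProdFinEquiv.sum_comp, Fintype.sum_prod_type]
  have h : ∀ x y : Fin n, (matrixUnitTensor n (finProdFinEquiv (x, y))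
      ⊗ₖ (matrixUnitTensor n (finProdFinEquiv (x, y))).map (starRingEnd ℂ)) (i, k) (j, l)
      = (n : ℂ)⁻¹ * ((if x = i ∧ y = j then 1 else 0) * (if x = k ∧ y = l then 1 else 0)) := by
    intro x y
    rw [← sqrt_inv_mul_self]
    simp only [matrixUnitTensor, Equiv.symm_apply_apply, Matrix.kroneckerMap_apply,
      Matrix.smul_apply, Matrix.map_apply, Matrix.single_apply, smul_eq_mul, map_mul, map_inv₀,
      Complex.conj_ofReal]
    split_ifs <;> simp
  simp only [h, ← Finset.mul_sum]
  rw [Matrix.smul_apply, smul_eq_mul]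
  congr 1
  simp only [vecMulVec_apply, vec, Matrix.one_apply, ite_and]
  by_cases h1 : i = k <;> by_cases h2 : j = l <;> simp [h1, h2, eq_comm]

theorem transferMatrix_matrixUnitTensor_mulVec (n : ℕ) (x : Fin n × Fin n → ℂ) :
    transferMatrix (matrixUnitTensor n) *ᵥ x = ((n : ℂ)⁻¹ * (vec 1 ⬝ᵥ x)) • vec 1 := by
  rw [transferMatrix_matrixUnitTensor, Matrix.smul_mulVec, Matrix.vecMulVec_mulVec]
  ext i
  simp [mul_assoc]

theorem isInjectiveMPS_matrixUnitTensor (n : ℕ) [NeZero n] :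
    IsInjectiveMPS (matrixUnitTensor n) := by
  have hn : (n : ℂ) ≠ 0 := Nat.cast_ne_zero.2 (NeZero.ne n)
  have hfix : transferMatrix (matrixUnitTensor n) *ᵥ vec 1 = vec 1 := by
    rw [transferMatrix_matrixUnitTensor_mulVec, vec_dotProduct_vec]
    simp [hn]
  have hvec : vec (1 : Matrix (Fin n) (Fin n) ℂ) ≠ 0 := by
    rw [Ne, vec_eq_zero_iff]
    exact one_ne_zero
  refine ⟨?_, ⟨1, Matrix.PosDef.one, ?_⟩, ?_, ?_⟩
  · have h := mixedTransfer_transpose_mulVec_vec (matrixUnitTensor n) (matrixUnitTensor n) 1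
    have h2 : (mixedTransfer (matrixUnitTensor n) (matrixUnitTensor n))ᵀ
        = transferMatrix (matrixUnitTensor n) := by
      change (transferMatrix (matrixUnitTensor n))ᵀ = _
      rw [transferMatrix_matrixUnitTensor, Matrix.transpose_smul, Matrix.transpose_vecMulVec]
    rw [h2, hfix, vec_inj, dualTransfer] at h
    simpa using h.symm
  · have h : transferMatrix (matrixUnitTensor n) *ᵥ vec 1
        = vec (∑ s, matrixUnitTensor n s * 1 * (matrixUnitTensor n s)ᴴ)ᵀ := by
      rw [transferMatrix, Matrix.sum_mulVec, Matrix.transpose_sum, vec_sum]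
      refine Finset.sum_congr rfl fun s _ => ?_
      rw [kronecker_mulVec_vec, Matrix.transpose_mul, Matrix.mul_one, Matrix.mul_one]
      congr 2
    rw [hfix, vec_inj] at h
    rw [← Matrix.transpose_transpose (∑ s, _), ← h, Matrix.transpose_one]
  · have hmem : vec 1 ∈ Module.End.eigenspace (Matrix.toLin' (transferMatrix (matrixUnitTensor n)))
        1 := Module.End.mem_eigenspace_iff.2 (by simpa using hfix)
    refine (finrank_eq_one_iff_of_nonzero' (⟨vec 1, hmem⟩ : Module.End.eigenspace _ _)
      fun h0 => hvec (congrArg Subtype.val h0)).2 ?_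
    · rintro ⟨x, hx⟩
      have hx' : transferMatrix (matrixUnitTensor n) *ᵥ x = x := by
        simpa using Module.End.mem_eigenspace_iff.1 hx
      rw [transferMatrix_matrixUnitTensor_mulVec] at hx'
      exact ⟨_, Subtype.ext hx'⟩
  · intro μ hμ hμ1
    obtain ⟨x, hx⟩ := hμ.exists_hasEigenvector
    have hx' : transferMatrix (matrixUnitTensor n) *ᵥ x = μ • x := hx.apply_eq_smul
    by_cases hμ0 : μ = 0
    · simp [hμ0]
    refine absurd ?_ hμ1
    -- An eigenvector with nonzero eigenvalue lies in the range, spanned by the fixed vector `vec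
    -- 1`.
    have h1 : x = (μ⁻¹ * ((n : ℂ)⁻¹ * (vec 1 ⬝ᵥ x))) • vec 1 := by
      rw [mul_smul, ← transferMatrix_matrixUnitTensor_mulVec, hx', inv_smul_smul₀ hμ0]
    have h2 : transferMatrix (matrixUnitTensor n) *ᵥ x = x := by
      rw [h1, Matrix.mulVec_smul, hfix]
    have h3 : μ • x = (1 : ℂ) • x := by rw [← hx', h2, one_smul]
    exact smul_left_injective ℂ hx.2 h3

variable {G : Type*} [Group G] {n : ℕ}

/-- The linear representation `V* ⊗ V` built from a projective representation `V`. -/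
def conjTensorMatrix (V : unitaryGroup (Fin n) ℂ) : Matrix (Fin (n * n)) (Fin (n * n)) ℂ :=
  (V.1.map (starRingEnd ℂ) ⊗ₖ V.1).submatrix finProdFinEquiv.symm finProdFinEquiv.symm

theorem conjTensorMatrix_mul (V W : unitaryGroup (Fin n) ℂ) :
    conjTensorMatrix V * conjTensorMatrix W = conjTensorMatrix (V * W) := by
  rw [conjTensorMatrix, conjTensorMatrix, Matrix.submatrix_mul_equiv, ← mul_kronecker_mul,
    ← Matrix.map_mul]
  rfl

theorem conjTensorMatrix_one : conjTensorMatrix (1 : unitaryGroup (Fin n) ℂ) = 1 := by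
  have h : ((1 : unitaryGroup (Fin n) ℂ).1).map (starRingEnd ℂ) = 1 := by simp
  rw [conjTensorMatrix, h]
  change ((1 : Matrix (Fin n) (Fin n) ℂ) ⊗ₖ (1 : Matrix (Fin n) (Fin n) ℂ)).submatrix _ _ = 1
  rw [one_kronecker_one, Matrix.submatrix_one_equiv]

theorem conjTensorMatrix_star (V : unitaryGroup (Fin n) ℂ) :
    star (conjTensorMatrix V) = conjTensorMatrix (star V) := by
  rw [conjTensorMatrix, Matrix.star_eq_conjTranspose, Matrix.conjTranspose_submatrix,
    Matrix.conjTranspose_kronecker]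
  rfl

theorem conjTensorMatrix_mem (V : unitaryGroup (Fin n) ℂ) :
    conjTensorMatrix V ∈ unitaryGroup (Fin (n * n)) ℂ := by
  rw [Matrix.mem_unitaryGroup_iff, conjTensorMatrix_star, conjTensorMatrix_mul,
    Unitary.mul_star_self, conjTensorMatrix_one]

/-- A phase of `V` cancels against its conjugate; hence a projective `V` yields a linear on-site
representation. -/
theorem conjTensorMatrix_smul {V W : unitaryGroup (Fin n) ℂ} {z : Circle}
    (h : V.1 = (z : ℂ) • W.1) : conjTensorMatrix V = conjTensorMatrix W := by
  ext s t
  have hz : starRingEnd ℂ (z : ℂ) * z = 1 := by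
    rw [← Complex.normSq_eq_conj_mul_self, Circle.normSq_coe]
    simp
  simp only [conjTensorMatrix, h, Matrix.submatrix_apply, Matrix.kroneckerMap_apply,
    Matrix.map_apply, Matrix.smul_apply, smul_eq_mul, map_mul]
  rw [mul_mul_mul_comm, hz, one_mul]

/-- The linear representation `V* ⊗ V` of a projective representation `V`. -/
def conjTensorRep {V : G → unitaryGroup (Fin n) ℂ} {ω : G → G → Circle}
    (h : IsFactorSystem V ω) : G →* unitaryGroup (Fin (n * n)) ℂ :=
  MonoidHom.mk' (fun g => ⟨conjTensorMatrix (V g), conjTensorMatrix_mem _⟩) fun g k => by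
    refine Subtype.ext ?_
    change conjTensorMatrix (V (g * k)) = conjTensorMatrix (V g) * conjTensorMatrix (V k)
    rw [conjTensorMatrix_mul]
    exact (conjTensorMatrix_smul (h g k)).symm

/-- The physical index is a pair of bond indices, so acting by `V* ⊗ V` on it conjugates the matrix
units on the bonds. -/
theorem siteAct_conjTensorMatrix (V : unitaryGroup (Fin n) ℂ) (s : Fin (n * n)) :
    siteAct (conjTensorMatrix V) (matrixUnitTensor n) s = V.1ᴴ * matrixUnitTensor n s * V.1 := by
  obtain ⟨⟨i, j⟩, rfl⟩ := finProdFinEquiv.surjective s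
  ext p q
  rw [siteAct, Matrix.sum_apply, ← finProdFinEquiv.sum_comp, Fintype.sum_prod_type]
  simp only [conjTensorMatrix, matrixUnitTensor, Equiv.symm_apply_apply, Matrix.submatrix_apply,
    Matrix.kroneckerMap_apply, Matrix.map_apply, Matrix.smul_apply, smul_eq_mul,
    Matrix.mul_smul, Matrix.smul_mul]
  have h : (V.1ᴴ * Matrix.single i j (1 : ℂ) * V.1) p q = starRingEnd ℂ (V.1 i p) * V.1 j q := by
    rw [Matrix.mul_apply, Finset.sum_eq_single j]
    · simp [Matrix.mul_apply, Matrix.single_apply]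
    · intro x _ hx
      simp [Matrix.mul_apply, hx.symm]
    · simp
  rw [h]
  simp [Matrix.single_apply, ite_and]
  ring

theorem prod_ofFn_conj {m : ℕ} (V : unitaryGroup (Fin n) ℂ) (f : Fin m → Matrix (Fin n) (Fin n) ℂ) :
    (List.ofFn fun i => V.1ᴴ * f i * V.1).prod = V.1ᴴ * (List.ofFn f).prod * V.1 := by
  have h1 : V.1ᴴ * V.1 = 1 := Unitary.coe_star_mul_self V
  have h2 : V.1 * V.1ᴴ = 1 := Unitary.coe_mul_star_self V
  induction m with
  | zero => simp [h1]
  | succ m ih =>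
    rw [List.ofFn_succ, List.prod_cons, ih, List.ofFn_succ, List.prod_cons]
    calc _ = V.1ᴴ * f 0 * (V.1 * V.1ᴴ) * (List.ofFn fun i => f i.succ).prod * V.1 := by
          simp only [Matrix.mul_assoc]
      _ = _ := by rw [h2, Matrix.mul_one, Matrix.mul_assoc V.1ᴴ (f 0)]

end FixedPointTensor

end ModulatedMPS
end

noncomputable section
namespace ModulatedMPS
open Matrix
open scoped Kronecker ComplexOrder

/-! ### Cohomology of `ℤ_N × ℤ_N`. -/

section CyclicGroups

/-- Every `U(1)`-valued 2-cocycle on a cyclic group is a coboundary. -/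
theorem Z2_le_B2_of_isCyclic (G : Type*) [CommGroup G] [IsCyclic G] : Z2 G ≤ B2 G := by
  intro ω hω
  rw [mem_B2_iff hω]
  obtain ⟨x, hx⟩ := IsCyclic.exists_generator (α := G)
  intro g h
  obtain ⟨m, rfl⟩ := hx g
  obtain ⟨n, rfl⟩ := hx h
  -- The pairing of two powers of `x` is a power of the pairing of `x` with itself, which is `1`.
  change commutatorPairing ⟨ω, hω⟩ (x ^ m) (x ^ n) = 1
  rw [map_zpow, map_zpow, MonoidHom.zpow_apply, commutatorPairing_apply]
  simp [-Matrix.one_zpow]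

theorem commutatorPairing_eq_mixedPhase {Ga Gb : Type*} [CommGroup Ga] [CommGroup Gb]
    [IsCyclic Ga] [IsCyclic Gb] (ω : Z2 (Ga × Gb)) (g h : Ga × Gb) :
    commutatorPairing ω g h = mixedPhase ω.1 g.1 h.2 / mixedPhase ω.1 h.1 g.2 := by
  have hA : commutatorPairing ω (g.1, 1) (h.1, 1) = 1 :=
    div_swap_eq_one_of_mem_B2 (Z2_le_B2_of_isCyclic Ga (sectorA_mem_Z2 ω)) g.1 h.1
  have hB : commutatorPairing ω (1, g.2) (1, h.2) = 1 :=
    div_swap_eq_one_of_mem_B2 (Z2_le_B2_of_isCyclic Gb (sectorB_mem_Z2 ω)) g.2 h.2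
  rw [commutatorPairing_prod, hA, hB, one_mul, one_mul]

theorem H2.mk_eq_mk_iff_mixedPhase {Ga Gb : Type*} [CommGroup Ga] [CommGroup Gb]
    [IsCyclic Ga] [IsCyclic Gb] {ω η : Z2 (Ga × Gb)} :
    H2.mk ω = H2.mk η ↔ ∀ ga gb, mixedPhase ω.1 ga gb = mixedPhase η.1 ga gb := by
  rw [H2.mk_eq_mk_iff_commutatorPairing]
  constructor
  · intro h ga gb
    exact DFunLike.congr_fun (DFunLike.congr_fun h (ga, 1)) (1, gb)
  · intro h
    ext g k
    rw [commutatorPairing_eq_mixedPhase, commutatorPairing_eq_mixedPhase, h, h]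

variable {N : ℕ} [NeZero N]

theorem exists_toCircle_eq {z : Circle} (hz : z ^ N = 1) : ∃ k : ZMod N, ZMod.toCircle k = z := by
  have h1 : Units.mk0 (z : ℂ) (Circle.coe_ne_zero z) ∈ rootsOfUnity N ℂ := by
    rw [mem_rootsOfUnity']
    exact_mod_cast congrArg (fun w : Circle => (w : ℂ)) hz
  obtain ⟨i, -, hi⟩ := (Complex.mem_rootsOfUnity N _).1 h1
  refine ⟨i, Circle.ext ?_⟩
  rw [ZMod.toCircle_natCast, ← mul_div_assoc']
  exact hi

/-- By bimultiplicativity the phase is fixed by its value on the pair of generators, an `N`-th root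
of unity. -/
theorem mixedPhase_eq_toCircle
    (ω : Z2 (Multiplicative (ZMod N) × Multiplicative (ZMod N))) :
    ∃ k : ZMod N, ∀ x y : ZMod N,
      mixedPhase ω.1 (Multiplicative.ofAdd x) (Multiplicative.ofAdd y)
        = ZMod.toCircle (k * x * y) := by
  set t : Multiplicative (ZMod N) := Multiplicative.ofAdd 1 with ht
  have hpow : ∀ x : ZMod N, Multiplicative.ofAdd x = t ^ x.val := fun x => by
    rw [ht, ← ofAdd_nsmul, nsmul_one, ZMod.natCast_zmod_val]
  have hmul : ∀ m n : ℕ, mixedPhase ω.1 (t ^ m) (t ^ n) = mixedPhase ω.1 t t ^ (m * n) := by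
    intro m n
    have h : commutatorPairing ω ((t, 1) ^ m) ((1, t) ^ n)
        = commutatorPairing ω (t, 1) (1, t) ^ (m * n) := by
      rw [map_pow, map_pow, MonoidHom.pow_apply, ← pow_mul]
    simp only [Prod.pow_mk, one_pow] at h
    exact h
  have hN : mixedPhase ω.1 t t ^ N = 1 := by
    have h := hmul N 1
    have ht1 : t ^ N = 1 := by
      rw [ht, ← ofAdd_nsmul, nsmul_one, CharP.cast_eq_zero, ofAdd_zero]
    rw [mul_one, ht1, pow_one] at h
    rw [← h]
    exact DFunLike.congr_fun (map_one (commutatorPairing ω)) (1, t)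
  obtain ⟨k, hk⟩ := exists_toCircle_eq hN
  refine ⟨k, fun x y => ?_⟩
  rw [hpow x, hpow y, hmul, ← hk, ← AddChar.map_nsmul_eq_pow]
  congr 1
  rw [nsmul_eq_mul, Nat.cast_mul, ZMod.natCast_zmod_val, ZMod.natCast_zmod_val]
  ring

/-- The cocycle on `ℤ_N × ℤ_N` with commutator phase `exp (2πi k x y / N)`. -/
def mixedCocycle (k : ZMod N) : Z2 (Multiplicative (ZMod N) × Multiplicative (ZMod N)) :=
  -- In the mixed phase only the denominator is nontrivial, whence the minus sign; bilinearity gives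
  -- the cocycle identity.
  ⟨fun g h => ZMod.toCircle (-(k * g.2.toAdd * h.1.toAdd)), fun g h l => by
    simp only [← AddChar.map_add_eq_mul, Prod.fst_mul, Prod.snd_mul, toAdd_mul]
    congr 1
    ring⟩

theorem mixedPhase_mixedCocycle (k x y : ZMod N) :
    mixedPhase (mixedCocycle k).1 (Multiplicative.ofAdd x) (Multiplicative.ofAdd y)
      = ZMod.toCircle (k * x * y) := by
  simp [mixedPhase, mixedCocycle, AddChar.map_neg_eq_inv, mul_right_comm]

variable (N) in
/-- The classes of `ℤ_N × ℤ_N`, as a homomorphism from `ℤ_N`. -/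
def mixedClass :
    Multiplicative (ZMod N) →* H2 (Multiplicative (ZMod N) × Multiplicative (ZMod N)) :=
  MonoidHom.mk' (fun k => H2.mk (mixedCocycle k.toAdd)) fun k l => by
    change H2.mk _ = H2.mk (mixedCocycle k.toAdd * mixedCocycle l.toAdd)
    congr 1
    refine Subtype.ext ?_
    funext g h
    change ZMod.toCircle _ = ZMod.toCircle _ * ZMod.toCircle _
    rw [← AddChar.map_add_eq_mul]
    congr 1
    rw [toAdd_mul]
    ring

variable (N) in
theorem mixedClass_bijective : Function.Bijective (mixedClass N) := by
  constructor
  · intro k l h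
    have h1 := H2.mk_eq_mk_iff_mixedPhase.1 h (Multiplicative.ofAdd 1) (Multiplicative.ofAdd 1)
    rw [mixedPhase_mixedCocycle, mixedPhase_mixedCocycle, mul_one, mul_one, mul_one, mul_one] at h1
    exact Multiplicative.toAdd.injective (ZMod.injective_toCircle h1)
  · intro c
    obtain ⟨ω, rfl⟩ := QuotientGroup.mk_surjective c
    obtain ⟨k, hk⟩ := mixedPhase_eq_toCircle ω
    refine ⟨Multiplicative.ofAdd k, H2.mk_eq_mk_iff_mixedPhase.2 fun g h => ?_⟩
    exact (mixedPhase_mixedCocycle k g.toAdd h.toAdd).trans (hk g.toAdd h.toAdd).symm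

variable (N) in
/-- The isomorphism `H²(ℤ_N × ℤ_N, U(1)) ≅ ℤ_N`. -/
def classEquiv :
    H2 (Multiplicative (ZMod N) × Multiplicative (ZMod N)) ≃* Multiplicative (ZMod N) :=
  (MulEquiv.ofBijective (mixedClass N) (mixedClass_bijective N)).symm

theorem mk_mixedCocycle_classEquiv
    (c : H2 (Multiplicative (ZMod N) × Multiplicative (ZMod N))) :
    H2.mk (mixedCocycle (classEquiv N c).toAdd) = c :=
  (MulEquiv.ofBijective (mixedClass N) (mixedClass_bijective N)).apply_symm_apply c

theorem mixedPhase_eq_classEquiv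
    (ω : Z2 (Multiplicative (ZMod N) × Multiplicative (ZMod N))) (x y : ZMod N) :
    mixedPhase ω.1 (Multiplicative.ofAdd x) (Multiplicative.ofAdd y)
      = ZMod.toCircle ((classEquiv N (H2.mk ω)).toAdd * x * y) := by
  rw [← mixedPhase_mixedCocycle]
  exact H2.mk_eq_mk_iff_mixedPhase.1 (mk_mixedCocycle_classEquiv (H2.mk ω)).symm _ _

/-- Write `N = g M` and `c = g e` with `g` the gcd. Then `e` is coprime to `M`, so `N ∣ k c` reduces
to `M ∣ k`. -/
theorem dvd_val_iff_mul_eq_zero (k : ZMod N) (c : ℤ) :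
    N / Int.gcd c N ∣ k.val ↔ k * (c : ZMod N) = 0 := by
  have hN : 0 < N := NeZero.pos N
  set g := Int.gcd c N with hg
  have hgpos : 0 < g := Int.gcd_pos_of_ne_zero_right _ (by exact_mod_cast hN.ne')
  obtain ⟨M, hM⟩ : g ∣ N := by exact_mod_cast Int.gcd_dvd_right c N
  obtain ⟨e, he⟩ : (g : ℤ) ∣ c := Int.gcd_dvd_left c N
  have hcop : IsCoprime (M : ℤ) e := by
    rw [Int.isCoprime_iff_gcd_eq_one, Int.gcd_comm]
    have h1 : Int.gcd c N = g * Int.gcd e M := by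
      conv_lhs => rw [he, hM, Nat.cast_mul, Int.gcd_mul_left, Int.natAbs_natCast]
    rw [← hg] at h1
    exact (Nat.eq_of_mul_eq_mul_left hgpos (by rw [← h1, mul_one])).symm
  have hk : k * (c : ZMod N) = ((k.val * c : ℤ) : ZMod N) := by
    push_cast
    rw [ZMod.natCast_zmod_val]
  have hdiv : N / g = M := by
    conv_lhs => rw [hM]
    exact Nat.mul_div_cancel_left _ hgpos
  rw [hdiv, hk, ZMod.intCast_zmod_eq_zero_iff_dvd]
  have hN' : (N : ℤ) = g * M := by exact_mod_cast hM
  have hc : (k.val : ℤ) * c = g * (k.val * e) := by rw [he]; ring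
  rw [hN', hc, mul_dvd_mul_iff_left (by exact_mod_cast hgpos.ne'),
    ← Int.natCast_dvd_natCast]
  exact ⟨fun h => h.mul_right e, hcop.dvd_of_dvd_mul_right⟩

theorem mem_zpowers_ofAdd_natCast_iff {n : ℕ} (hn : n ∣ N) (k : Multiplicative (ZMod N)) :
    k ∈ Subgroup.zpowers (Multiplicative.ofAdd (n : ZMod N)) ↔ n ∣ k.toAdd.val := by
  rw [Subgroup.mem_zpowers_iff]
  constructor
  · rintro ⟨z, rfl⟩
    rw [← Int.natCast_dvd_natCast, ← ofAdd_zsmul, toAdd_ofAdd, zsmul_eq_mul]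
    have h : (((((z : ZMod N) * n).val : ℤ) - z * n : ℤ) : ZMod N) = 0 := by
      push_cast
      rw [ZMod.natCast_zmod_val, sub_self]
    rw [ZMod.intCast_zmod_eq_zero_iff_dvd] at h
    have h2 : (n : ℤ) ∣ (((z : ZMod N) * n).val : ℤ) - z * n :=
      (Int.natCast_dvd_natCast.2 hn).trans h
    exact (dvd_sub_left (Dvd.intro_left z rfl)).1 h2
  · rintro ⟨m, hm⟩
    refine ⟨m, Multiplicative.toAdd.injective ?_⟩
    rw [← ofAdd_zsmul, toAdd_ofAdd, zsmul_eq_mul, Int.cast_natCast, mul_comm, ← Nat.cast_mul, ← hm,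
      ZMod.natCast_zmod_val]

/-- The subgroup of multiples of `N / g` in `ℤ_N` is isomorphic to `ℤ_g`. -/
theorem nonempty_zpowers_equiv {g : ℕ} (hg : g ∣ N) :
    Nonempty (Subgroup.zpowers (Multiplicative.ofAdd ((N / g : ℕ) : ZMod N))
      ≃* Multiplicative (ZMod g)) := by
  have hN : 0 < N := NeZero.pos N
  have hg0 : 0 < g := Nat.pos_of_dvd_of_pos hg hN
  refine ⟨mulEquivOfCyclicCardEq ?_⟩
  rw [Nat.card_zpowers, orderOf_ofAdd_eq_addOrderOf, ZMod.addOrderOf_coe _ hN.ne',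
    Nat.gcd_eq_right (Nat.div_dvd_of_dvd hg), Nat.div_div_self hg hN.ne']
  change _ = Nat.card (ZMod g)
  rw [Nat.card_zmod]

end CyclicGroups

/-! ### Generalized Pauli matrices and realization of the allowed classes. -/

section Weyl

variable {N : ℕ} [NeZero N]

/-- Generalized Pauli matrices `X^x Z^{k y}`. -/
def weylMatrix (k : ZMod N) (g : Multiplicative (ZMod N) × Multiplicative (ZMod N)) :
    Matrix (ZMod N) (ZMod N) ℂ :=
  Matrix.of fun p q =>
    if q = p + g.1.toAdd then (ZMod.toCircle (k * g.2.toAdd * q) : ℂ) else 0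

/-- The diagonal phase of `g` is evaluated before the shift by `h.1`; the discrepancy is the
cocycle. -/
theorem weylMatrix_mul (k : ZMod N) (g h : Multiplicative (ZMod N) × Multiplicative (ZMod N)) :
    weylMatrix k g * weylMatrix k h = ((mixedCocycle k).1 g h : ℂ) • weylMatrix k (g * h) := by
  ext p r
  rw [Matrix.mul_apply, Finset.sum_eq_single (p + g.1.toAdd)]
  · by_cases h1 : r = p + g.1.toAdd + h.1.toAdd
    · have h2 : r = p + (g.1.toAdd + h.1.toAdd) := by rw [h1, add_assoc]
      simp only [weylMatrix, mixedCocycle, Matrix.of_apply, Matrix.smul_apply, Prod.fst_mul,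
        Prod.snd_mul, toAdd_mul, smul_eq_mul, if_pos, if_pos h1, if_pos h2, ← Circle.coe_mul,
        ← AddChar.map_add_eq_mul]
      congr 2
      rw [h1]
      ring
    · have h2 : r ≠ p + (g.1.toAdd + h.1.toAdd) := by rwa [← add_assoc]
      simp only [weylMatrix, Matrix.of_apply, Matrix.smul_apply, Prod.fst_mul, toAdd_mul,
        if_neg h1, if_neg h2, mul_zero, smul_zero]
  · intro q _ hq
    simp only [weylMatrix, Matrix.of_apply, if_neg hq, zero_mul]
  · simp

theorem weylMatrix_conjTranspose_mul (k : ZMod N)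
    (g : Multiplicative (ZMod N) × Multiplicative (ZMod N)) :
    (weylMatrix k g)ᴴ * weylMatrix k g = 1 := by
  ext p r
  rw [Matrix.mul_apply, Finset.sum_eq_single (p - g.1.toAdd)]
  · by_cases h : p = r
    · subst h
      simp [weylMatrix, Matrix.conjTranspose_apply, ← Complex.normSq_eq_conj_mul_self]
    · simp [weylMatrix, Matrix.conjTranspose_apply, h, Ne.symm h]
  · intro q _ hq
    have : p ≠ q + g.1.toAdd := fun h => hq (by rw [h, add_sub_cancel_right])
    simp [weylMatrix, Matrix.conjTranspose_apply, this]
  · simp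

/-- The projective representation of `ℤ_N × ℤ_N` by generalized Pauli matrices. -/
def weylUnitary (k : ZMod N) (g : Multiplicative (ZMod N) × Multiplicative (ZMod N)) :
    unitaryGroup (Fin N) ℂ :=
  ⟨(weylMatrix k g).submatrix (ZMod.finEquiv N) (ZMod.finEquiv N), by
    rw [Matrix.mem_unitaryGroup_iff', Matrix.star_eq_conjTranspose, Matrix.conjTranspose_submatrix]
    change (weylMatrix k g)ᴴ.submatrix (ZMod.finEquiv N).toEquiv (ZMod.finEquiv N).toEquiv
      * (weylMatrix k g).submatrix (ZMod.finEquiv N).toEquiv (ZMod.finEquiv N).toEquiv = 1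
    rw [Matrix.submatrix_mul_equiv, weylMatrix_conjTranspose_mul, Matrix.submatrix_one_equiv]⟩

theorem isFactorSystem_weylUnitary (k : ZMod N) :
    IsFactorSystem (weylUnitary k) (mixedCocycle k).1 := by
  intro g h
  change (weylMatrix k g).submatrix (ZMod.finEquiv N).toEquiv (ZMod.finEquiv N).toEquiv
      * (weylMatrix k h).submatrix (ZMod.finEquiv N).toEquiv (ZMod.finEquiv N).toEquiv = _
  rw [Matrix.submatrix_mul_equiv, weylMatrix_mul]
  rfl

/-- The second group element enters only through `k * g.2`, and `k * b = k`, so the modulated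
symmetry acts uniformly. -/
theorem siteUnitary_conjTensorRep {k : ZMod N} {b : ℤ} (hk : k * ((b - 1 : ℤ) : ZMod N) = 0) (j : ℕ)
    (g : Multiplicative (ZMod N) × Multiplicative (ZMod N)) :
    siteUnitary (conjTensorRep (isFactorSystem_weylUnitary k)) 1 b j g
      = conjTensorRep (isFactorSystem_weylUnitary k) g := by
  have hkb : k * (b : ZMod N) = k := by
    push_cast at hk
    rwa [mul_sub, mul_one, sub_eq_zero] at hk
  have hkbj : k * (b : ZMod N) ^ j = k := by
    induction j with
    | zero => simp
    | succ j ih => rw [pow_succ, ← mul_assoc, ih, hkb]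
  have hV : weylUnitary k (g.1 ^ (1 : ℤ) ^ j, g.2 ^ b ^ j) = weylUnitary k g := by
    refine Subtype.ext ?_
    change (weylMatrix k _).submatrix _ _ = (weylMatrix k _).submatrix _ _
    congr 1
    ext p q
    simp only [weylMatrix, Matrix.of_apply, one_pow, zpow_one, toAdd_zpow, zsmul_eq_mul,
      Int.cast_pow, ← mul_assoc, hkbj]
  rw [siteUnitary_eq]
  refine Subtype.ext ?_
  change conjTensorMatrix _ = conjTensorMatrix _
  rw [hV]

/-- Every class invariant under the exponential modulation is realized by a symmetric MPS. -/
theorem mk_mixedCocycle_mem_sptClasses {k : ZMod N} {b : ℤ}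
    (hk : k * ((b - 1 : ℤ) : ZMod N) = 0) (L : ℕ) [NeZero L] :
    H2.mk (mixedCocycle k)
      ∈ sptClasses (Multiplicative (ZMod N)) (Multiplicative (ZMod N)) 1 b L := by
  set U := conjTensorRep (isFactorSystem_weylUnitary k) with hU
  have hsite : ∀ j g, siteUnitary U 1 b j g = U g := siteUnitary_conjTensorRep hk
  refine ⟨N * N, N, matrixUnitTensor N, U, isInjectiveMPS_matrixUnitTensor N, ?_,
    fun _ => weylUnitary k, ?_, fun _ => ⟨mixedCocycle k, isFactorSystem_weylUnitary k, rfl⟩⟩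
  · intro g m _
    -- The same unitary sits on every bond and cancels around the trace, so the eigenvalue is `1`.
    refine ⟨1, fun s => ?_⟩
    rw [sum_prod_mul_mpsState (fun i => (siteUnitary U 1 b (i.val % L) g).1)]
    simp only [hsite]
    have h : ∀ s, siteAct (U g).1 (matrixUnitTensor N) s
        = (weylUnitary k g).1ᴴ * matrixUnitTensor N s * (weylUnitary k g).1 :=
      siteAct_conjTensorMatrix (weylUnitary k g)
    have h2 : (weylUnitary k g).1 * (weylUnitary k g).1ᴴ = 1 := Unitary.coe_mul_star_self _
    simp only [h]
    rw [prod_ofFn_conj, Matrix.mul_assoc, Matrix.trace_mul_comm, Matrix.mul_assoc, h2,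
      Matrix.mul_one, Circle.coe_one, one_mul, mpsState]
  · intro i g
    refine ⟨1, fun s => ?_⟩
    change siteAct (siteUnitary U 1 b i.val g).1 (matrixUnitTensor N) s = _
    rw [hsite, Circle.coe_one, one_smul]
    exact siteAct_conjTensorMatrix (weylUnitary k g) s

end Weyl

end ModulatedMPS
end

/-! ### The cocycle constraints and the classification. -/

noncomputable section
namespace ModulatedMPS

theorem IsFactorSystem.unique {G : Type*} [Group G] {χ : ℕ} [Nonempty (Fin χ)]
    {v : G → Matrix.unitaryGroup (Fin χ) ℂ} {ω η : G → G → Circle} (hω : IsFactorSystem v ω)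
    (hη : IsFactorSystem v η) : ω = η := by
  funext g h
  exact smul_unitary_injective (v (g * h)) ((hω g h).symm.trans (hη g h))

theorem exists_class_of_isSymmetricMPS {Ga Gb : Type*} [CommGroup Ga] [CommGroup Gb] {a b : ℤ}
    {L : ℕ} [NeZero L] (ha : ∀ g : Ga, g ^ (a ^ L) = g) (hb : ∀ g : Gb, g ^ (b ^ L) = g)
    {d χ : ℕ} {A : Fin d → Matrix (Fin χ) (Fin χ) ℂ} {U : Ga × Gb →* Matrix.unitaryGroup (Fin d) ℂ}
    (hA : IsInjectiveMPS A) (hS : IsSymmetricMPS A U a b L) :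
    ∃ c : H2 (Ga × Gb), ∀ v : Fin L → Ga × Gb → Matrix.unitaryGroup (Fin χ) ℂ,
      IsBondUnitaries A (fun i g => siteUnitary U a b i.val g) v →
      ∀ i, ∃ ω : Z2 (Ga × Gb), IsFactorSystem (v i) ω.1 ∧ H2.mk ω = c ∧
        sectorA ω.1 ^ (a ^ 2 - 1) ∈ B2 Ga ∧
        sectorMixed ω.1 ^ (a * b - 1) ∈ B2 (Ga × Gb) ∧
        (∀ ga gb, mixedPhase ω.1 ga gb ^ (a * b - 1) = 1) ∧
        sectorB ω.1 ^ (b ^ 2 - 1) ∈ B2 Gb := by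
  have hW : ∀ (i : Fin L) (g h : Ga × Gb), siteUnitary U a b i.val (g * h)
      = siteUnitary U a b i.val g * siteUnitary U a b i.val h :=
    fun i => siteUnitary_mul U a b i.val
  obtain ⟨v₀, hv₀⟩ := hS.exists_isBondUnitaries hA
  obtain ⟨ω₀, hω₀⟩ := hv₀.exists_factorSystem hA hW 0
  refine ⟨H2.mk ω₀, fun v hv i => ?_⟩
  obtain ⟨ω, hω⟩ := hv.exists_factorSystem hA hW i
  exact ⟨ω, hω, hv.mk_eq_mk hA hW hv₀ hω hω₀,
    sector_constraints a b ω (hv.commutatorPairing_invariant hA ha hb hω)⟩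

theorem mem_sptClasses_iff {N : ℕ} [NeZero N] {b : ℤ} {L : ℕ} [NeZero L]
    (hb : ∀ g : Multiplicative (ZMod N), g ^ (b ^ L) = g)
    (c : H2 (Multiplicative (ZMod N) × Multiplicative (ZMod N))) :
    c ∈ sptClasses (Multiplicative (ZMod N)) (Multiplicative (ZMod N)) 1 b L ↔
      N / Int.gcd (b - 1) N ∣ (classEquiv N c).toAdd.val := by
  rw [dvd_val_iff_mul_eq_zero]
  constructor
  · rintro ⟨d, χ, A, U, hA, hS, v, hv, hc⟩
    have := hA.nonempty
    obtain ⟨ω, hω, hωc⟩ := hc 0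
    obtain ⟨_, hclass⟩ := exists_class_of_isSymmetricMPS (by simp) hb hA hS
    obtain ⟨η, hη, -, -, -, hphase, -⟩ := hclass v hv 0
    obtain rfl : ω = η := Subtype.ext (hω.unique hη)
    -- For `a = 1`, the constraint at the pair of generators says that `ZMod.toCircle k` has `(b -
    -- 1)`-st power `1`, that is, `k (b - 1) = 0`.
    have h := hphase (Multiplicative.ofAdd 1) (Multiplicative.ofAdd 1)
    rw [mixedPhase_eq_classEquiv, hωc, ← AddChar.map_zsmul_eq_zpow, ← AddChar.map_zero_eq_one
      (ZMod.toCircle (N := N))] at h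
    have h2 := ZMod.injective_toCircle h
    rwa [zsmul_eq_mul, mul_one, mul_one, one_mul, mul_comm] at h2
  · intro h
    have h2 := mk_mixedCocycle_mem_sptClasses h L
    rwa [mk_mixedCocycle_classEquiv] at h2

end ModulatedMPS
end
open ModulatedMPS in
theorem mainTheorem5 :
    -- the cocycle constraints for two exponential symmetries with exponents `a` and `b`
    (∀ (Ga : Type*) (Gb : Type*) [CommGroup Ga] [CommGroup Gb] (a b : ℤ) (L : ℕ) [NeZero L],
      (∀ g : Ga, g ^ (a ^ L) = g) → (∀ g : Gb, g ^ (b ^ L) = g) →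
      ∀ (d χ : ℕ) (A : Fin d → Matrix (Fin χ) (Fin χ) ℂ)
        (U : Ga × Gb →* Matrix.unitaryGroup (Fin d) ℂ),
        IsInjectiveMPS A → IsSymmetricMPS A U a b L →
        (∃ v : Fin L → Ga × Gb → Matrix.unitaryGroup (Fin χ) ℂ,
          IsBondUnitaries A (fun i g => siteUnitary U a b i.val g) v) ∧
        ∃ c : H2 (Ga × Gb), ∀ v : Fin L → Ga × Gb → Matrix.unitaryGroup (Fin χ) ℂ,
          IsBondUnitaries A (fun i g => siteUnitary U a b i.val g) v →
          ∀ i, ∃ ω : Z2 (Ga × Gb), IsFactorSystem (v i) ω.1 ∧ H2.mk ω = c ∧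
            sectorA ω.1 ^ (a ^ 2 - 1) ∈ B2 Ga ∧
            sectorMixed ω.1 ^ (a * b - 1) ∈ B2 (Ga × Gb) ∧
            (∀ ga gb, mixedPhase ω.1 ga gb ^ (a * b - 1) = 1) ∧
            sectorB ω.1 ^ (b ^ 2 - 1) ∈ B2 Gb) ∧
    -- the classification for `Ga = Gb = ℤ_N` and `a = 1`
    (∀ (N : ℕ) [NeZero N] (b : ℤ) (L : ℕ) [NeZero L],
      (∀ g : Multiplicative (ZMod N), g ^ (b ^ L) = g) →
      Z2 (Multiplicative (ZMod N)) ≤ B2 (Multiplicative (ZMod N)) ∧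
      ∃ κ : H2 (Multiplicative (ZMod N) × Multiplicative (ZMod N)) ≃* Multiplicative (ZMod N),
        (∀ (ω : Z2 (Multiplicative (ZMod N) × Multiplicative (ZMod N))) (x y : ZMod N),
          (mixedPhase ω.1 (Multiplicative.ofAdd x) (Multiplicative.ofAdd y) : ℂ)
            = Complex.exp (2 * Real.pi * Complex.I
                * ((Multiplicative.toAdd (κ (H2.mk ω))).val * x.val * y.val : ℕ) / N)) ∧
        (∀ c, c ∈ sptClasses (Multiplicative (ZMod N)) (Multiplicative (ZMod N)) 1 b L ↔
          N / Int.gcd (b - 1) N ∣ (Multiplicative.toAdd (κ c)).val) ∧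
        ∃ S : Subgroup (H2 (Multiplicative (ZMod N) × Multiplicative (ZMod N))),
          (S : Set _) = sptClasses (Multiplicative (ZMod N)) (Multiplicative (ZMod N)) 1 b L ∧
          Nonempty (S ≃* Multiplicative (ZMod (Int.gcd (b - 1) N)))) := by
  refine ⟨fun Ga Gb _ _ a b L _ ha hb d χ A U hA hS =>
    ⟨hS.exists_isBondUnitaries hA, exists_class_of_isSymmetricMPS ha hb hA hS⟩, ?_⟩
  intro N _ b L _ hb
  refine ⟨Z2_le_B2_of_isCyclic _, classEquiv N, fun ω x y => ?_, mem_sptClasses_iff hb, ?_⟩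
  · rw [mixedPhase_eq_classEquiv, ← ZMod.toCircle_natCast]
    simp only [Nat.cast_mul, ZMod.natCast_zmod_val]
  · have hdvd : Int.gcd (b - 1) N ∣ N := by exact_mod_cast Int.gcd_dvd_right (b - 1) (N : ℤ)
    obtain ⟨e⟩ := nonempty_zpowers_equiv hdvd
    -- The subgroup is the preimage under `classEquiv` of the cyclic group generated by `N / gcd(b -
    -- 1, N)`.
    refine ⟨(Subgroup.zpowers _).map (classEquiv N).symm.toMonoidHom, ?_,
      ⟨((classEquiv N).symm.subgroupMap _).symm.trans e⟩⟩
    ext c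
    rw [mem_sptClasses_iff hb, ← mem_zpowers_ofAdd_natCast_iff (Nat.div_dvd_of_dvd hdvd),
      SetLike.mem_coe]
    exact Subgroup.mem_map_equiv
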